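/- Let $\widehat G$ be a finite group, $G\le\widehat G$ a subgroup of index $2$, and $w\in\widehat G\setminus G$. An A-representation is a complex vector space with a real-linear action of $\widehat G$ in which the elements of $G$ act $\mathbb C$-linearly and the elements of $\widehat G\setminus G$ act antilinearly; equivalently, a module over the skew group algebra $\mathbb C{*}\widehat G$ (complex basis $\widehat G$, product $(a\,x)(b\,y)=a\,({}^{x}b)\,xy$, where ${}^{x}b=b$ for $x\in G$ and ${}^{x}b=\overline b$ for $x\notin G$). $\mathrm{End}_A(W)$ is the real algebra of $\mathbb C$-linear $\widehat G$-equivariant endomorphisms of $W$, $W{\downarrow}$ is the restriction of $W$ to $G$, and $V{\uparrow}=\mathbb C{*}\widehat G\otimes_{\mathbb CG}V$ for a $\mathbb CG$-module $V$. Further, $w\cdot\overline V$ is the complex conjugate space $\overline V$ on which $g\in G$ acts as $wgw^{-1}$ does on $V$. The module $V$ is Realisable if it is the restriction of an A-representation. A bilinear form $B$ on $V$ is $w$-invariant if $B(gu,wgw^{-1}v)=B(u,v)$ for all $g\in G$ and $u,v\in V$; it is $w$-symmetric if $B(u,w^2v)=B(v,u)$ and $w$-alternating if $B(u,w^2v)=-B(v,u)$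 for all $u,v\in V$. The Real Frobenius–Schur indicator of $V$ with character $\chi$ is $\mathcal F(V)=\frac1{|G|}\sum_{z\in\widehat G\setminus G}\chi(z^2)$. **Theorem.** Let $W$ be an irreducible A-representation and $V$ an irreducible subrepresentation of $W{\downarrow}$. Then $W$ and $V$ are as in one of the columns of the following table, where the first row is an isomorphism of $\mathbb R$-algebras, the second one of $\mathbb C$-algebras, and $n\ge1$ is an integer. | | type $\mathbb R$ | type $\mathbb C$ | type $\mathbb H$ | |---|---|---|---| | $\mathrm{End}_A(W)\cong$ | $\mathbb R$ | $\mathbb C$ | $\mathbb H$ | | $\mathrm{End}_{\mathbb CG}(W)\cong$ | $\mathbb C$ | $\mathbb C\times\mathbb C$ | $M_2(\mathbb C)$ | | $W{\downarrow}\cong$ | $V$ | $V\oplus w\cdot\overline V$ | $V\oplus V$ | | $V{\uparrow}\cong$ | $W\oplus W$ | $W$ | $W$ | | $\dim_{\mathbb C}W$ | $n$ | $2n$ | $2n$ | | $\dim_{\mathbb C}V$ | $n$ | $n$ | $n$ | | $V\cong w\cdot\overline V$? | yes | no | yes | | $V$ Realisable? | yes | no | no | | $w$-invariant bilinear forms on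 $V$ | a non-degenerate one exists, and all are $w$-symmetric | only $0$ | a non-degenerate one exists, and all are $w$-alternating | | $\mathcal F(V)$ | $1$ | $0$ | $-1$ | -/

import Mathlib

open scoped TensorProduct Quaternion ComplexConjugate

noncomputable section

namespace RealRep

universe u v

/-! ### C₂-graded groups: a finite group `Γ` with a subgroup `G` of index 2 -/

section GradedGroup

variable {Γ : Type u} [Group Γ] (G : Subgroup Γ)

instance normal_of_index_two [hG : Fact (G.index = 2)] : G.Normal :=
  Subgroup.normal_of_index_eq_two hG.out

open Classical in
/-- The field automorphism of `ℂ` attached to `z : Γ`: the identity if `z` is even (`z ∈ G`),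
complex conjugation if `z` is odd. -/
def twist (z : Γ) : ℂ →+* ℂ := if z ∈ G then RingHom.id ℂ else starRingEnd ℂ

theorem twist_of_mem {z : Γ} (hz : z ∈ G) : twist G z = RingHom.id ℂ := if_pos hz

theorem twist_of_notMem {z : Γ} (hz : z ∉ G) : twist G z = starRingEnd ℂ := if_neg hz

theorem twist_mul [hG : Fact (G.index = 2)] (x y : Γ) (c : ℂ) :
    twist G (x * y) c = twist G x (twist G y c) := by
  have h := Subgroup.mul_mem_iff_of_index_two hG.out (a := x) (b := y)
  by_cases hx : x ∈ G <;> by_cases hy : y ∈ G <;> simp [twist, h, hx, hy]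

/-- `Γ` acts on `ℂ` through its grading. -/
abbrev twistAction [Fact (G.index = 2)] : MulSemiringAction Γ ℂ where
  smul z c := twist G z c
  one_smul c := by
    change twist G 1 c = c
    rw [twist_of_mem G G.one_mem]; rfl
  mul_smul x y c := twist_mul G x y c
  smul_zero z := map_zero (twist G z)
  smul_add z := map_add (twist G z)
  smul_one z := map_one (twist G z)
  smul_mul z := map_mul (twist G z)

/-- The skew group algebra `ℂ ∗ Γ`: complex basis `Γ`, product `(a x)(b y) = a (ˣb) (x y)`. -/
def SkewGroupAlgebra {Γ : Type u} [Group Γ] (_G : Subgroup Γ) : Type u := SkewMonoidAlgebra ℂ Γ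

namespace SkewGroupAlgebra

instance instRing [Fact (G.index = 2)] : Ring (SkewGroupAlgebra G) :=
  letI := twistAction G
  inferInstanceAs (Ring (SkewMonoidAlgebra ℂ Γ))

variable {G}

/-- The element `c x` of the skew group algebra. -/
def single (x : Γ) (c : ℂ) : SkewGroupAlgebra G := SkewMonoidAlgebra.single x c

theorem single_mul_single [Fact (G.index = 2)] (x y : Γ) (a b : ℂ) :
    (single x a * single y b : SkewGroupAlgebra G) = single (x * y) (a * twist G x b) :=
  letI := twistAction G
  SkewMonoidAlgebra.single_mul_single (k := ℂ) (G := Γ)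

theorem single_one_one [Fact (G.index = 2)] : (single 1 1 : SkewGroupAlgebra G) = 1 := rfl

variable (G)

/-- The inclusion `ℂ → ℂ ∗ Γ`. -/
def ofComplex [Fact (G.index = 2)] : ℂ →+* SkewGroupAlgebra G :=
  letI := twistAction G
  (SkewMonoidAlgebra.singleOneRingHom : ℂ →+* SkewMonoidAlgebra ℂ Γ)

theorem ofComplex_apply [Fact (G.index = 2)] (c : ℂ) : ofComplex G c = single 1 c := rfl

end SkewGroupAlgebra

/-! ### Antilinear representations -/

/-- An A-representation of `G ≤ Γ` on a complex vector space `W`: a homomorphism from `Γ` to the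
(necessarily invertible) real-linear maps of `W`, with `G` acting complex linearly and `Γ ∖ G`
acting antilinearly. -/
structure ARep (W : Type v) [AddCommGroup W] [Module ℂ W] where
  /-- the action of `Γ` -/
  ρ : Γ →* Module.End ℝ W
  /-- even elements act linearly, odd elements antilinearly -/
  map_smul' : ∀ (z : Γ) (c : ℂ) (v : W), ρ z (c • v) = twist G z c • ρ z v

namespace ARep

variable {G}
variable {W : Type*} [AddCommGroup W] [Module ℂ W] {W' : Type*} [AddCommGroup W'] [Module ℂ W']

/-- Restriction (Complexification): the complex representation of `G` underlying an
A-representation. -/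
def res (σ : ARep G W) : Representation ℂ G W where
  toFun g :=
    { toFun := σ.ρ g
      map_add' := map_add (σ.ρ g)
      map_smul' := fun c v => by rw [σ.map_smul', twist_of_mem G g.2] }
  map_one' := by ext v; simp
  map_mul' g h := by ext v; simp

/-- The direct sum of two A-representations. -/
def prod (σ : ARep G W) (τ : ARep G W') : ARep G (W × W') where
  ρ :=
    { toFun := fun z => LinearMap.prodMap (σ.ρ z) (τ.ρ z)
      map_one' := by ext v <;> simp
      map_mul' := fun x y => by ext v <;> simp }
  map_smul' z c v := by
    ext
    · exact σ.map_smul' z c v.1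
    · exact τ.map_smul' z c v.2

/-- Isomorphism of A-representations. -/
def IsIso (σ : ARep G W) (τ : ARep G W') : Prop :=
  ∃ e : W ≃ₗ[ℂ] W', ∀ (z : Γ) (v : W), e (σ.ρ z v) = τ.ρ z (e v)

/-- Irreducibility: `W ≠ 0`, and the only A-subrepresentations are `0` and `W`. -/
def IsIrreducible (σ : ARep G W) : Prop :=
  Nontrivial W ∧ ∀ U : Submodule ℂ W, (∀ (z : Γ), ∀ v ∈ U, σ.ρ z v ∈ U) → U = ⊥ ∨ U = ⊤

/-- The real algebra `End_A(W)` of A-endomorphisms. -/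
def endA (σ : ARep G W) : Subalgebra ℝ (Module.End ℂ W) where
  carrier := {f | ∀ (z : Γ) (v : W), f (σ.ρ z v) = σ.ρ z (f v)}
  mul_mem' := fun {f g} hf hg z v => by
    rw [Module.End.mul_apply, Module.End.mul_apply, hg, hf]
  add_mem' := fun {f g} hf hg z v => by
    rw [LinearMap.add_apply, LinearMap.add_apply, hf, hg, map_add]
  algebraMap_mem' := fun r z v => by
    rw [Module.algebraMap_end_apply, Module.algebraMap_end_apply, map_smul]

end ARep

/-! ### Complex representations of `G`: Realisation, twists, forms, indicator -/

variable {G}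
variable {V : Type v} [AddCommGroup V] [Module ℂ V]

/-- A complex representation of `G` is Realisable if it is the restriction of an
A-representation. (Transporting the action along an isomorphism, it is the same to ask that it be
isomorphic to such a restriction.) -/
def IsRealisable (ρ : Representation ℂ G V) : Prop := ∃ σ : ARep G V, σ.res = ρ

/-- The complex conjugate vector space. -/
def Conj (V : Type v) : Type v := V

namespace Conj

instance : AddCommGroup (Conj V) := inferInstanceAs (AddCommGroup V)

/-- `c` acts on the conjugate space as its conjugate acts on `V`. -/
instance : Module ℂ (Conj V) := Module.compHom V (starRingEnd ℂ)

/-- A linear map, seen as a linear map of the conjugate space. -/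
def map (f : V →ₗ[ℂ] V) : Conj V →ₗ[ℂ] Conj V where
  toFun := f
  map_add' := map_add f
  map_smul' c v := map_smul f (conj c) (show V from v)

end Conj

/-- The conjugate representation. -/
def conjRep (ρ : Representation ℂ G V) : Representation ℂ G (Conj V) where
  toFun g := Conj.map (ρ g)
  map_one' := by rw [map_one]; rfl
  map_mul' g h := by rw [map_mul]; rfl

/-- The twist `w · V`: the space `V` on which `g` acts as `w g w⁻¹`. -/
def twistRep [Fact (G.index = 2)] (w : Γ) (ρ : Representation ℂ G V) : Representation ℂ G V :=
  ρ.comp (MulAut.conjNormal w : MulAut G).toMonoidHom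

/-- `B(g u, w g w⁻¹ v) = B(u, v)`. -/
def IsInvariantForm [Fact (G.index = 2)] (w : Γ) (ρ : Representation ℂ G V)
    (B : LinearMap.BilinForm ℂ V) : Prop :=
  ∀ (g : G) (u v : V), B (ρ g u) (ρ (MulAut.conjNormal w g) v) = B u v

/-- The square of an element of `Γ`, as an element of `G`. -/
def sq [hG : Fact (G.index = 2)] (z : Γ) : G := ⟨z ^ 2, Subgroup.sq_mem_of_index_two hG.out z⟩

/-- `B(u, w² v) = B(v, u)`. -/
def IsSymmetricForm [Fact (G.index = 2)] (w : Γ) (ρ : Representation ℂ G V)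
    (B : LinearMap.BilinForm ℂ V) : Prop :=
  ∀ u v : V, B u (ρ (sq w) v) = B v u

/-- `B(u, w² v) = - B(v, u)`. -/
def IsAlternatingForm [Fact (G.index = 2)] (w : Γ) (ρ : Representation ℂ G V)
    (B : LinearMap.BilinForm ℂ V) : Prop :=
  ∀ u v : V, B u (ρ (sq w) v) = - B v u

open Classical in
/-- The Real Frobenius–Schur indicator `|G|⁻¹ ∑_{z ∈ Γ ∖ G} χ(z²)`. -/
def indicator [Fintype Γ] [Fact (G.index = 2)] (ρ : Representation ℂ G V) : ℂ :=
  (Nat.card G : ℂ)⁻¹ * ∑ z : {z : Γ // z ∉ G}, ρ.character (sq z.1)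

/-! ### Induction (Realification): `(ℂ ∗ Γ) ⊗_{ℂG} V` -/

section Induction

variable [Fact (G.index = 2)]

/-- The relations `s r ⊗ v = s ⊗ r v` of the tensor product over `ℂG`, for `r = c g` in the
additive generating set `{c g | c ∈ ℂ, g ∈ G}` of `ℂG`. The span over `ℂ ∗ Γ` (acting on the left)
is their additive span, as left multiplication permutes the relations. -/
def balancedRelations (ρ : Representation ℂ G V) :
    Submodule (SkewGroupAlgebra G) (SkewGroupAlgebra G ⊗[ℤ] V) :=
  Submodule.span (SkewGroupAlgebra G)
    {x | ∃ (s : SkewGroupAlgebra G) (c : ℂ) (g : G) (v : V),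
      x = (s * SkewGroupAlgebra.single (g : Γ) c) ⊗ₜ[ℤ] v - s ⊗ₜ[ℤ] (c • ρ g v)}

/-- The space `(ℂ ∗ Γ) ⊗_{ℂG} V`. -/
def Induced (ρ : Representation ℂ G V) : Type max u v :=
  (SkewGroupAlgebra G ⊗[ℤ] V) ⧸ balancedRelations ρ

namespace Induced

variable (ρ : Representation ℂ G V)

instance : AddCommGroup (Induced ρ) :=
  inferInstanceAs (AddCommGroup ((SkewGroupAlgebra G ⊗[ℤ] V) ⧸ balancedRelations ρ))

instance instModuleSkew : Module (SkewGroupAlgebra G) (Induced ρ) :=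
  inferInstanceAs
    (Module (SkewGroupAlgebra G) ((SkewGroupAlgebra G ⊗[ℤ] V) ⧸ balancedRelations ρ))

/-- The complex structure is that of the left `ℂ ∗ Γ`-module. -/
instance instModuleComplex : Module ℂ (Induced ρ) :=
  Module.compHom (Induced ρ) (SkewGroupAlgebra.ofComplex G)

theorem smul_def (c : ℂ) (x : Induced ρ) :
    c • x = (SkewGroupAlgebra.single 1 c : SkewGroupAlgebra G) • x := rfl

theorem single_smul_smul (z : Γ) (c : ℂ) (x : Induced ρ) :
    (SkewGroupAlgebra.single z 1 : SkewGroupAlgebra G) • c • x =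
      twist G z c • (SkewGroupAlgebra.single z 1 : SkewGroupAlgebra G) • x := by
  rw [smul_def, smul_def, smul_smul, smul_smul, SkewGroupAlgebra.single_mul_single,
    SkewGroupAlgebra.single_mul_single]
  simp

end Induced

/-- The A-representation `V↑ = (ℂ ∗ Γ) ⊗_{ℂG} V`, on which `z : Γ` acts as left multiplication
by `z`. -/
def ind (ρ : Representation ℂ G V) : ARep G (Induced ρ) where
  ρ :=
    { toFun := fun z =>
        { toFun := fun x => (SkewGroupAlgebra.single z 1 : SkewGroupAlgebra G) • x
          map_add' := smul_add _
          map_smul' := fun r x => by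
            rw [RingHom.id_apply, ← Complex.coe_smul, ← Complex.coe_smul,
              Induced.single_smul_smul]
            congr 1
            by_cases hz : z ∈ G
            · rw [twist_of_mem G hz]; rfl
            · rw [twist_of_notMem G hz, Complex.conj_ofReal] }
      map_one' := by
        ext x
        change (SkewGroupAlgebra.single 1 1 : SkewGroupAlgebra G) • x = x
        rw [SkewGroupAlgebra.single_one_one, one_smul]
      map_mul' := fun y z => by
        ext x
        change (SkewGroupAlgebra.single (y * z) 1 : SkewGroupAlgebra G) • x =
          (SkewGroupAlgebra.single y 1 : SkewGroupAlgebra G) •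
            (SkewGroupAlgebra.single z 1 : SkewGroupAlgebra G) • x
        rw [smul_smul, SkewGroupAlgebra.single_mul_single]
        simp }
  map_smul' z c x := Induced.single_smul_smul ρ z c x

end Induction

end GradedGroup

end RealRep

end

/-! Fix the odd element `w`. The map `(u, v) ↦ u + w⁻¹ v` from `V ⊕ w·V̄` to `W` is `G`-equivariant,
and its image is stable under `w`, so it is onto. The subspace `V ∩ w⁻¹V` is also stable under `Γ`,
hence is `0` or `W`. So either `V = W`, or `W↓ ≅ V ⊕ w·V̄` (`eq_top_or_bijective_oddSum`).

The finer division comes from antilinear maps `J : V → V` with `J g = (w g w⁻¹) J`, that is, linear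
`G`-maps `V → w·V̄`. By Schur's lemma they form a space of dimension at most one, and a nonzero `J`
satisfies `J² = r w²` with `r` real and nonzero, so it can be scaled to `J² = ± w²`. The sign `+`
says exactly that `J` extends the action of `G` to one of `Γ`. If `V = W`, then `J = w` has sign
`+`: type ℝ. If `W↓ ≅ V ⊕ w·V̄`, sign `+` is impossible, since `{v + w⁻¹ J v}` would be a proper
nonzero A-subrepresentation (`not_isRealisable_of_injective`). So either `J` exists with sign `-`
(type ℍ), or there is no nonzero `J` (type ℂ).

The rest follows. `End_A(W)` consists of the scalars, pairs of scalars or `2 × 2` matrices of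
Schur's lemma that commute with `w`. An invariant Hermitian form `h` makes `J ↦ h(J ·, ·)` a
correspondence with the `w`-invariant bilinear forms, and positivity of `h` identifies the sign of
`J²` with the symmetry type (`IsTwisted.forms`). Finally, the indicator is the common symmetry sign
times the dimension of the space of invariant forms (`indicator_eq_mul_finrank`). -/

noncomputable section

namespace RealRep

/-! ### Schur's lemma and endomorphisms of a sum of two irreducibles -/

section Schur

variable {H : Type*} [Group H] {V V₁ : Type*} [AddCommGroup V] [Module ℂ V]
  [AddCommGroup V₁] [Module ℂ V₁]

theorem isIrreducible_iff (ρ : Representation ℂ H V) :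
    ρ.IsIrreducible ↔ Nontrivial V ∧
      ∀ U : Submodule ℂ V, (∀ g, ∀ v ∈ U, ρ g v ∈ U) → U = ⊥ ∨ U = ⊤ := by
  constructor
  · intro h
    constructor
    · by_contra hV
      rw [not_nontrivial_iff_subsingleton] at hV
      obtain ⟨x, y, hxy⟩ := h.toNontrivial
      exact hxy (Subrepresentation.toSubmodule_injective (Subsingleton.elim _ _))
    · intro U hU
      refine (h.eq_bot_or_eq_top ⟨U, fun g v hv => hU g v hv⟩).imp (fun h => ?_) fun h => ?_
      · exact congrArg Subrepresentation.toSubmodule h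
      · exact congrArg Subrepresentation.toSubmodule h
  · rintro ⟨hV, h⟩
    refine { exists_pair_ne := ⟨⊥, ⊤, fun h => ?_⟩, eq_bot_or_eq_top := fun U => ?_ }
    · exact bot_ne_top (α := Submodule ℂ V) (congrArg Subrepresentation.toSubmodule h)
    · exact (h U.toSubmodule fun g v hv => U.apply_mem_toSubmodule g hv).imp
        (fun h => Subrepresentation.toSubmodule_injective h)
        (fun h => Subrepresentation.toSubmodule_injective h)

theorem nontrivial_of_isIrreducible {ρ : Representation ℂ H V} (hρ : ρ.IsIrreducible) :
    Nontrivial V := ((isIrreducible_iff ρ).1 hρ).1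

theorem exists_eq_smul [FiniteDimensional ℂ V] {ρ : Representation ℂ H V} (hρ : ρ.IsIrreducible)
    (f : V →ₗ[ℂ] V) (hf : ∀ g v, f (ρ g v) = ρ g (f v)) : ∃ c : ℂ, ∀ v, f v = c • v := by
  obtain ⟨c, hc⟩ :=
    Representation.IsIrreducible.algebraMap_intertwiningMap_bijective_of_isAlgClosed (ρ := ρ)
      |>.surjective (f.intertwiningMap_of_isIntertwiningMap ρ ρ hf)
  refine ⟨c, fun v => ?_⟩
  exact (congrArg (fun F : ρ.IntertwiningMap ρ => F v) hc).symm

/-- Conjugation of equivariant endomorphisms by an isomorphism. -/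
def intertwiningConj {ρ : Representation ℂ H V} {τ : Representation ℂ H V₁} (e : ρ.Equiv τ) :
    ρ.IntertwiningMap ρ ≃ₐ[ℂ] τ.IntertwiningMap τ where
  toFun f := (e.toIntertwiningMap.comp f).comp e.symm.toIntertwiningMap
  invFun f := (e.symm.toIntertwiningMap.comp f).comp e.toIntertwiningMap
  left_inv f := by ext v; simp
  right_inv f := by ext v; simp
  map_mul' f g := by ext v; simp
  map_add' f g := by ext v; simp
  commutes' c := by ext v; simp

theorem nonempty_intertwining_algEquiv {A : Type*} [Semiring A] [Algebra ℂ A]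
    {ρ : Representation ℂ H V} (φ : A →ₐ[ℂ] Module.End ℂ V) (hinj : Function.Injective φ)
    (hφ : ∀ a g v, φ a (ρ g v) = ρ g (φ a v))
    (hsurj : ∀ f : Module.End ℂ V, (∀ g v, f (ρ g v) = ρ g (f v)) → ∃ a, φ a = f) :
    Nonempty (ρ.IntertwiningMap ρ ≃ₐ[ℂ] A) := by
  let ψ : A →ₐ[ℂ] ρ.IntertwiningMap ρ :=
    { toFun := fun a => (φ a).intertwiningMap_of_isIntertwiningMap _ _ (hφ a)
      map_one' := Representation.IntertwiningMap.ext (map_one φ)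
      map_mul' := fun a b => Representation.IntertwiningMap.ext (map_mul φ a b)
      map_zero' := Representation.IntertwiningMap.ext (map_zero φ)
      map_add' := fun a b => Representation.IntertwiningMap.ext (map_add φ a b)
      commutes' := fun c => Representation.IntertwiningMap.ext (AlgHom.commutes φ c) }
  refine ⟨(AlgEquiv.ofBijective ψ ⟨fun a b h => ?_, fun f => ?_⟩).symm⟩
  · exact hinj (congrArg Representation.IntertwiningMap.toLinearMap h)
  · obtain ⟨a, ha⟩ := hsurj f.toLinearMap f.isIntertwining
    exact ⟨a, Representation.IntertwiningMap.ext ha⟩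

theorem isIrreducible_of_equiv {ρ : Representation ℂ H V} {τ : Representation ℂ H V₁}
    (e : ρ.Equiv τ) (hτ : τ.IsIrreducible) : ρ.IsIrreducible := by
  rw [isIrreducible_iff] at hτ ⊢
  have := hτ.1
  have he (g : H) (v : V) : e (ρ g v) = τ g (e v) :=
    Representation.IntertwiningMap.isIntertwining _ _ e.toIntertwiningMap g v
  refine ⟨e.toLinearEquiv.toEquiv.nontrivial, fun U hU => ?_⟩
  refine (hτ.2 (U.map e.toLinearEquiv.toLinearMap) ?_).imp (fun h => ?_) fun h => ?_
  · rintro g _ ⟨v, hv, rfl⟩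
    exact ⟨ρ g v, hU g v hv, he g v⟩
  · rwa [Submodule.map_eq_bot_iff] at h
  · refine Submodule.eq_top_iff'.2 fun v => ?_
    obtain ⟨u, hu, huv⟩ := Submodule.eq_top_iff'.1 h (e v)
    exact e.toLinearEquiv.injective huv ▸ hu

/-- The linear endomorphism of `V ⊕ V₁` acting by scalars on the summands. -/
def diagEnd (V V₁ : Type*) [AddCommGroup V] [Module ℂ V] [AddCommGroup V₁] [Module ℂ V₁] :
    ℂ × ℂ →ₐ[ℂ] Module.End ℂ (V × V₁) where
  toFun c := LinearMap.prodMap (c.1 • LinearMap.id) (c.2 • LinearMap.id)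
  map_one' := by ext v <;> simp
  map_mul' c d := by ext v <;> simp [smul_smul, mul_comm]
  map_zero' := by ext v <;> simp
  map_add' c d := by ext v <;> simp [add_smul]
  commutes' c := by ext v <;> simp

theorem diagEnd_apply (c : ℂ × ℂ) (x : V × V₁) :
    diagEnd V V₁ c x = (c.1 • x.1, c.2 • x.2) := rfl

theorem diagEnd_injective [Nontrivial V] [Nontrivial V₁] :
    Function.Injective (diagEnd V V₁) := by
  intro c d h
  obtain ⟨v, hv⟩ := exists_ne (0 : V)
  obtain ⟨v', hv'⟩ := exists_ne (0 : V₁)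
  have h' := DFunLike.congr_fun h (v, v')
  ext
  · exact smul_left_injective ℂ hv (congrArg Prod.fst h')
  · exact smul_left_injective ℂ hv' (congrArg Prod.snd h')

theorem diagEnd_comm (ρ : Representation ℂ H V) (τ : Representation ℂ H V₁) (c : ℂ × ℂ) (g : H)
    (x : V × V₁) : diagEnd V V₁ c (ρ.prod τ g x) = ρ.prod τ g (diagEnd V V₁ c x) := by
  ext <;> simp [diagEnd_apply]

/-- Of the four blocks of `f`, Schur's lemma makes the diagonal ones scalars and kills the
off-diagonal ones, which join non-isomorphic irreducibles. -/
theorem exists_diagEnd_eq [FiniteDimensional ℂ V] [FiniteDimensional ℂ V₁]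
    {ρ : Representation ℂ H V} {τ : Representation ℂ H V₁} (hρ : ρ.IsIrreducible)
    (hτ : τ.IsIrreducible) (hne : ¬ Nonempty (ρ.Equiv τ)) (f : V × V₁ →ₗ[ℂ] V × V₁)
    (hf : ∀ g x, f (ρ.prod τ g x) = ρ.prod τ g (f x)) : ∃ c, diagEnd V V₁ c = f := by
  let F : (ρ.prod τ).IntertwiningMap (ρ.prod τ) := f.intertwiningMap_of_isIntertwiningMap _ _ hf
  let f₁₁ := ((Representation.IntertwiningMap.fst ℂ ρ τ).comp F).comp (.inl ℂ ρ τ)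
  let f₁₂ := ((Representation.IntertwiningMap.fst ℂ ρ τ).comp F).comp (.inr ℂ ρ τ)
  let f₂₁ := ((Representation.IntertwiningMap.snd ℂ ρ τ).comp F).comp (.inl ℂ ρ τ)
  let f₂₂ := ((Representation.IntertwiningMap.snd ℂ ρ τ).comp F).comp (.inr ℂ ρ τ)
  obtain ⟨a, ha⟩ := exists_eq_smul hρ f₁₁.toLinearMap f₁₁.isIntertwining
  obtain ⟨b, hb⟩ := exists_eq_smul hτ f₂₂.toLinearMap f₂₂.isIntertwining
  have h₂₁ : f₂₁ = 0 := (Representation.IsIrreducible.bijective_or_eq_zero f₂₁).resolve_left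
    fun h => hne ⟨f₂₁.ofBijective h⟩
  have h₁₂ : f₁₂ = 0 := (Representation.IsIrreducible.bijective_or_eq_zero f₁₂).resolve_left
    fun h => hne ⟨(f₁₂.ofBijective h).symm⟩
  refine ⟨(a, b), LinearMap.prod_ext (LinearMap.ext fun v => ?_) (LinearMap.ext fun v => ?_)⟩
  · refine Prod.ext (ha v).symm ?_
    exact (smul_zero b).trans (DFunLike.congr_fun h₂₁ v).symm
  · refine Prod.ext ?_ (hb v).symm
    exact (smul_zero a).trans (DFunLike.congr_fun h₁₂ v).symm

theorem exists_algEquiv_prod [FiniteDimensional ℂ V] [FiniteDimensional ℂ V₁]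
    {ρ : Representation ℂ H V} {τ : Representation ℂ H V₁} (hρ : ρ.IsIrreducible)
    (hτ : τ.IsIrreducible) (hne : ¬ Nonempty (ρ.Equiv τ)) :
    Nonempty ((ρ.prod τ).IntertwiningMap (ρ.prod τ) ≃ₐ[ℂ] ℂ × ℂ) := by
  have := nontrivial_of_isIrreducible hρ
  have := nontrivial_of_isIrreducible hτ
  exact nonempty_intertwining_algEquiv (diagEnd V V₁) diagEnd_injective (diagEnd_comm ρ τ)
    (exists_diagEnd_eq hρ hτ hne)

/-- The linear endomorphism of `V ⊕ V` given by a matrix of scalars. -/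
def matrixEnd (V : Type*) [AddCommGroup V] [Module ℂ V] :
    Matrix (Fin 2) (Fin 2) ℂ →ₐ[ℂ] Module.End ℂ (V × V) where
  toFun M :=
    { toFun := fun x => (M 0 0 • x.1 + M 0 1 • x.2, M 1 0 • x.1 + M 1 1 • x.2)
      map_add' := fun x y => by ext <;> simp <;> abel
      map_smul' := fun c x => by ext <;> simp [smul_smul, mul_comm] }
  map_one' := by ext v <;> simp
  map_mul' M N := by
    ext v <;> simp [Matrix.mul_apply, Fin.sum_univ_two, smul_smul, add_smul]
  map_zero' := by ext v <;> simp
  map_add' M N := by ext v <;> simp [add_smul]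
  commutes' c := by ext v <;> simp [Matrix.algebraMap_matrix_apply]

theorem matrixEnd_apply (M : Matrix (Fin 2) (Fin 2) ℂ) (x : V × V) :
    matrixEnd V M x = (M 0 0 • x.1 + M 0 1 • x.2, M 1 0 • x.1 + M 1 1 • x.2) := rfl

theorem matrixEnd_injective [Nontrivial V] : Function.Injective (matrixEnd V) := by
  intro M N h
  obtain ⟨v, hv⟩ := exists_ne (0 : V)
  have h₁ := LinearMap.congr_fun h (v, 0)
  have h₂ := LinearMap.congr_fun h (0, v)
  simp only [matrixEnd_apply, smul_zero, add_zero, zero_add, Prod.mk.injEq] at h₁ h₂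
  ext i j
  fin_cases i <;> fin_cases j
  · exact smul_left_injective ℂ hv h₁.1
  · exact smul_left_injective ℂ hv h₂.1
  · exact smul_left_injective ℂ hv h₁.2
  · exact smul_left_injective ℂ hv h₂.2

theorem matrixEnd_comm (ρ : Representation ℂ H V) (M : Matrix (Fin 2) (Fin 2) ℂ) (g : H)
    (x : V × V) : matrixEnd V M (ρ.prod ρ g x) = ρ.prod ρ g (matrixEnd V M x) := by
  ext <;> simp [matrixEnd_apply]

theorem exists_matrixEnd_eq [FiniteDimensional ℂ V] {ρ : Representation ℂ H V}
    (hρ : ρ.IsIrreducible) (f : V × V →ₗ[ℂ] V × V)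
    (hf : ∀ g x, f (ρ.prod ρ g x) = ρ.prod ρ g (f x)) : ∃ M, matrixEnd V M = f := by
  have key (p : V × V →ₗ[ℂ] V) (i : V →ₗ[ℂ] V × V)
      (hp : ∀ g x, p (ρ.prod ρ g x) = ρ g (p x)) (hi : ∀ g x, i (ρ g x) = ρ.prod ρ g (i x)) :
      ∃ c : ℂ, ∀ v, p (f (i v)) = c • v :=
    exists_eq_smul hρ (p ∘ₗ f ∘ₗ i) fun g v => by
      simp only [LinearMap.comp_apply, hi, hf, hp]
  have hl : ∀ g x, LinearMap.inl ℂ V V (ρ g x) = ρ.prod ρ g (LinearMap.inl ℂ V V x) := by simp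
  have hr : ∀ g x, LinearMap.inr ℂ V V (ρ g x) = ρ.prod ρ g (LinearMap.inr ℂ V V x) := by simp
  obtain ⟨a, ha⟩ := key (.fst ℂ V V) (.inl ℂ V V) (fun _ _ => rfl) hl
  obtain ⟨b, hb⟩ := key (.fst ℂ V V) (.inr ℂ V V) (fun _ _ => rfl) hr
  obtain ⟨c, hc⟩ := key (.snd ℂ V V) (.inl ℂ V V) (fun _ _ => rfl) hl
  obtain ⟨d, hd⟩ := key (.snd ℂ V V) (.inr ℂ V V) (fun _ _ => rfl) hr
  refine ⟨!![a, b; c, d], LinearMap.prod_ext (LinearMap.ext fun v => ?_)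
    (LinearMap.ext fun v => ?_)⟩
  · refine Prod.ext ((Eq.trans ?_ (ha v).symm)) ((Eq.trans ?_ (hc v).symm)) <;>
      simp [matrixEnd_apply]
  · refine Prod.ext ((Eq.trans ?_ (hb v).symm)) ((Eq.trans ?_ (hd v).symm)) <;>
      simp [matrixEnd_apply]

theorem exists_algEquiv_matrix [FiniteDimensional ℂ V] {ρ : Representation ℂ H V}
    (hρ : ρ.IsIrreducible) :
    Nonempty ((ρ.prod ρ).IntertwiningMap (ρ.prod ρ) ≃ₐ[ℂ] Matrix (Fin 2) (Fin 2) ℂ) := by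
  have := nontrivial_of_isIrreducible hρ
  exact nonempty_intertwining_algEquiv (matrixEnd V) matrixEnd_injective (matrixEnd_comm ρ)
    (exists_matrixEnd_eq hρ)

theorem exists_algEquiv_complex [FiniteDimensional ℂ V] {ρ : Representation ℂ H V}
    (hρ : ρ.IsIrreducible) : Nonempty (ρ.IntertwiningMap ρ ≃ₐ[ℂ] ℂ) :=
  ⟨(AlgEquiv.ofBijective (Algebra.ofId ℂ (ρ.IntertwiningMap ρ))
    Representation.IsIrreducible.algebraMap_intertwiningMap_bijective_of_isAlgClosed).symm⟩

end Schur

/-! ### Antilinear maps twisted by `w` -/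

section GradedGroup

variable {Γ : Type*} [Group Γ] {G : Subgroup Γ} {V : Type*} [AddCommGroup V] [Module ℂ V]

theorem rep_inv_apply_self (ρ : Representation ℂ G V) (g : G) (v : V) : ρ g⁻¹ (ρ g v) = v := by
  rw [← Module.End.mul_apply, ← map_mul]; simp

theorem rep_self_apply_inv (ρ : Representation ℂ G V) (g : G) (v : V) : ρ g (ρ g⁻¹ v) = v := by
  rw [← Module.End.mul_apply, ← map_mul]; simp

theorem ARep.mul_apply {W : Type*} [AddCommGroup W] [Module ℂ W] (σ : ARep G W) (x y : Γ) (v : W) :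
    σ.ρ (x * y) v = σ.ρ x (σ.ρ y v) := by rw [map_mul, Module.End.mul_apply]

variable [Fact (G.index = 2)]

theorem conjNormal_sq (w : Γ) : MulAut.conjNormal w (sq w : G) = sq w := by
  ext; simp [sq, MulAut.conjNormal_apply, pow_two, mul_assoc]

/-- Conjugating twice by `w` is conjugating by `w²`; hence a composite of two twisted maps differs
from a `G`-map by the factor `w²`. -/
theorem conjNormal_conjNormal_mul_sq (w : Γ) (g : G) :
    MulAut.conjNormal w (MulAut.conjNormal w g) * sq w = sq w * g := by
  ext; simp [sq, MulAut.conjNormal_apply, pow_two, mul_assoc]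

/-- `J (g v) = (w g w⁻¹) (J v)`, for an antilinear map `J` on a representation of `G`. -/
def IsTwisted (w : Γ) (ρ : Representation ℂ G V) (J : V →ₛₗ[starRingEnd ℂ] V) : Prop :=
  ∀ (g : G) (v : V), J (ρ g v) = ρ (MulAut.conjNormal w g) (J v)

namespace IsTwisted

variable {w : Γ} {ρ : Representation ℂ G V} {J J' : V →ₛₗ[starRingEnd ℂ] V}

theorem smul (hJ : IsTwisted w ρ J) (c : ℂ) : IsTwisted w ρ (c • J) := fun g v => by
  simp [hJ g v]

theorem apply_sq (hJ : IsTwisted w ρ J) (v : V) : J (ρ (sq w) v) = ρ (sq w) (J v) := by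
  rw [hJ, conjNormal_sq]

theorem injective (hJ : IsTwisted w ρ J) (hρ : ρ.IsIrreducible) (h0 : J ≠ 0) :
    Function.Injective J := by
  rw [← LinearMap.ker_eq_bot]
  refine (((isIrreducible_iff ρ).1 hρ).2 (LinearMap.ker J) fun g v hv => ?_).resolve_right
    fun h => h0 (LinearMap.ker_eq_top.1 h)
  rw [LinearMap.mem_ker] at hv ⊢
  rw [hJ, hv, map_zero]

/-- The two antilinearities and the two twists cancel: `w⁻² J J'` is linear and commutes with `G`,
so Schur's lemma applies. -/
theorem comp_eq_smul [FiniteDimensional ℂ V] (hJ : IsTwisted w ρ J) (hJ' : IsTwisted w ρ J')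
    (hρ : ρ.IsIrreducible) : ∃ c : ℂ, ∀ v, J (J' v) = c • ρ (sq w) v := by
  obtain ⟨c, hc⟩ := exists_eq_smul hρ (ρ (sq w)⁻¹ ∘ₗ J.comp J') fun g v => by
    simp only [LinearMap.comp_apply]
    rw [hJ', hJ, ← Module.End.mul_apply, ← map_mul, ← Module.End.mul_apply, ← map_mul]
    congr 2
    rw [inv_mul_eq_iff_eq_mul, ← mul_assoc, ← conjNormal_conjNormal_mul_sq]
    simp
  refine ⟨c, fun v => ?_⟩
  rw [← map_smul, ← hc, LinearMap.comp_apply, rep_self_apply_inv]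
  rfl

theorem comp_self_eq_smul [FiniteDimensional ℂ V] (hJ : IsTwisted w ρ J) (hρ : ρ.IsIrreducible)
    (h0 : J ≠ 0) : ∃ r : ℝ, r ≠ 0 ∧ ∀ v, J (J v) = (r : ℂ) • ρ (sq w) v := by
  obtain ⟨c, hc⟩ := hJ.comp_eq_smul hJ hρ
  have := nontrivial_of_isIrreducible hρ
  obtain ⟨v, hv⟩ := exists_ne (0 : V)
  have hinj := hJ.injective hρ h0
  have hJv : J v ≠ 0 := (map_ne_zero_iff J hinj).2 hv
  have hsq : ρ (sq w) (J v) ≠ 0 := fun h => hJv (by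
    rw [← rep_inv_apply_self ρ (sq w) (J v), h, map_zero])
  -- Two evaluations of `J³ v`; antilinearity conjugates `c` in one of them, so `c` is real.
  have h1 : conj c • ρ (sq w) (J v) = c • ρ (sq w) (J v) := by
    rw [← hc (J v), hc v, LinearMap.map_smulₛₗ, hJ.apply_sq]
  obtain ⟨r, rfl⟩ := Complex.conj_eq_iff_real.1 (smul_left_injective ℂ hsq h1)
  refine ⟨r, fun hr => hJv ?_, hc⟩
  have := hc v
  rw [hr, Complex.ofReal_zero, zero_smul] at this
  exact hinj (this.trans (map_zero J).symm)

theorem surjective [FiniteDimensional ℂ V] (hJ : IsTwisted w ρ J) (hρ : ρ.IsIrreducible)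
    (h0 : J ≠ 0) : Function.Surjective J := by
  obtain ⟨r, hr, h⟩ := hJ.comp_self_eq_smul hρ h0
  intro v
  refine ⟨J (ρ (sq w)⁻¹ ((r : ℂ)⁻¹ • v)), ?_⟩
  rw [h, rep_self_apply_inv, smul_smul, mul_inv_cancel₀ (by exact_mod_cast hr), one_smul]

theorem eq_smul [FiniteDimensional ℂ V] (hJ : IsTwisted w ρ J) (hJ' : IsTwisted w ρ J')
    (hρ : ρ.IsIrreducible) (h0 : J ≠ 0) : ∃ c : ℂ, J' = c • J := by
  obtain ⟨r, hr, h⟩ := hJ.comp_self_eq_smul hρ h0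
  obtain ⟨c, hc⟩ := hJ.comp_eq_smul hJ' hρ
  -- The scalar is found by applying the injective `J` to both sides, which conjugates it: `J J' = c
  -- w²` and `J J = r w²`.
  refine ⟨conj (c / r), LinearMap.ext fun v => hJ.injective hρ h0 ?_⟩
  rw [hc, LinearMap.smul_apply, LinearMap.map_smulₛₗ, h, Complex.conj_conj, smul_smul,
    div_mul_cancel₀ _ (by exact_mod_cast hr)]

/-- A nonzero `J` can be normalised to `J² = ± w²`. -/
theorem exists_normalised [FiniteDimensional ℂ V] (hJ : IsTwisted w ρ J) (hρ : ρ.IsIrreducible)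
    (h0 : J ≠ 0) : ∃ (δ : ℝ) (J' : V →ₛₗ[starRingEnd ℂ] V), (δ = 1 ∨ δ = -1) ∧
      IsTwisted w ρ J' ∧ ∀ v, J' (J' v) = (δ : ℂ) • ρ (sq w) v := by
  obtain ⟨r, hr, h⟩ := hJ.comp_self_eq_smul hρ h0
  have hpos : 0 < |r| := abs_pos.2 hr
  have hs : Real.sqrt |r| * Real.sqrt |r| = |r| := Real.mul_self_sqrt hpos.le
  -- Scaling `J` by `s` multiplies `J²` by `|s|²`, so only the absolute value of `r` can be removed;
  -- its sign is an invariant.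
  refine ⟨r / |r|, ((Real.sqrt |r|)⁻¹ : ℂ) • J, ?_, hJ.smul _, fun v => ?_⟩
  · rcases abs_choice r with h | h
    · left; rw [h, div_self hr]
    · right; rw [h, div_neg, div_self hr]
  · simp only [LinearMap.smul_apply, LinearMap.map_smulₛₗ, h, smul_smul]
    congr 1
    rw [map_inv₀, Complex.conj_ofReal]
    norm_cast
    rw [← mul_assoc, ← mul_inv, hs, div_eq_inv_mul]

end IsTwisted

/-! ### Twisted maps as isomorphisms onto `w·V̄` -/

section Iso

variable {w : Γ} {ρ : Representation ℂ G V}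

/-- An antilinear map, seen as a linear map to the conjugate space. -/
def toConj (J : V →ₛₗ[starRingEnd ℂ] V) : V →ₗ[ℂ] Conj V where
  toFun := J
  map_add' := map_add J
  map_smul' c v := by
    refine (LinearMap.map_smulₛₗ J c v).trans ?_
    rfl

/-- A linear map to the conjugate space, seen as an antilinear map. -/
def ofConj (f : V →ₗ[ℂ] Conj V) : V →ₛₗ[starRingEnd ℂ] V where
  toFun := f
  map_add' := map_add f
  map_smul' c v := by
    refine (LinearMap.map_smul f c v).trans ?_
    rfl

theorem IsTwisted.nonempty_equiv [FiniteDimensional ℂ V] {J : V →ₛₗ[starRingEnd ℂ] V}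
    (hJ : IsTwisted w ρ J) (hρ : ρ.IsIrreducible) (h0 : J ≠ 0) :
    Nonempty (ρ.Equiv (twistRep w (conjRep ρ))) :=
  ⟨.mk (LinearEquiv.ofBijective (toConj J) ⟨hJ.injective hρ h0, hJ.surjective hρ h0⟩) fun g =>
    LinearMap.ext fun v => hJ g v⟩

theorem exists_isTwisted_of_equiv [Nontrivial V] (e : ρ.Equiv (twistRep w (conjRep ρ))) :
    ∃ J, IsTwisted w ρ J ∧ J ≠ 0 := by
  refine ⟨ofConj e.toLinearMap, fun g v =>
    Representation.IntertwiningMap.isIntertwining _ _ e.toIntertwiningMap g v, fun h => ?_⟩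
  obtain ⟨v, hv⟩ := exists_ne (0 : V)
  apply hv
  have h1 : e v = 0 := DFunLike.congr_fun h v
  exact (map_eq_zero_iff e (EquivLike.injective e)).1 h1

/-- `V` and `w·V̄` have the same complex subspaces and the same operators; these are only relabelled
by an automorphism of `G`. -/
theorem isIrreducible_twistRep_conjRep (hρ : ρ.IsIrreducible) (w : Γ) :
    (twistRep w (conjRep ρ)).IsIrreducible := by
  rw [isIrreducible_iff] at hρ ⊢
  refine ⟨hρ.1, fun U hU => ?_⟩
  let U' : Submodule ℂ V :=
    { carrier := {v | (show Conj V from v) ∈ U}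
      add_mem' := fun ha hb => U.add_mem ha hb
      zero_mem' := U.zero_mem
      smul_mem' := fun c v hv => by
        have h := U.smul_mem (conj c) hv
        change (show V from ((conj (conj c)) • v : V)) ∈ U at h
        rwa [Complex.conj_conj] at h }
  refine (hρ.2 U' fun g v hv => ?_).imp (fun h => ?_) fun h => ?_
  · have := hU ((MulAut.conjNormal w).symm g) v hv
    change (ρ (MulAut.conjNormal w ((MulAut.conjNormal w).symm g)) v : V) ∈ U' at this
    rwa [MulEquiv.apply_symm_apply] at this
  · exact (Submodule.eq_bot_iff U).2 fun x hx => (Submodule.eq_bot_iff U').1 h x hx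
  · exact Submodule.eq_top_iff'.2 fun x => Submodule.eq_top_iff'.1 h x

theorem rank_conj (V : Type*) [AddCommGroup V] [Module ℂ V] :
    Module.rank ℂ (Conj V) = Module.rank ℂ V :=
  rank_eq_of_equiv_equiv (starRingEnd ℂ) (AddEquiv.refl V)
    (starRingAut : ℂ ≃+* ℂ).bijective fun c v => by
      change (conj c • (show V from v) : V) = _
      rfl

theorem finrank_conj (V : Type*) [AddCommGroup V] [Module ℂ V] :
    Module.finrank ℂ (Conj V) = Module.finrank ℂ V :=
  congrArg Cardinal.toNat (rank_conj V)

instance [FiniteDimensional ℂ V] : FiniteDimensional ℂ (Conj V) := by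
  rw [FiniteDimensional, ← Module.rank_lt_aleph0_iff, rank_conj]
  exact Module.rank_lt_aleph0 ℂ V

end Iso

/-! ### Realisability as the existence of `J` with `J² = w²` -/

section Realisable

variable {w : Γ} {ρ : Representation ℂ G V}

theorem mul_mem_iff_of_notMem {x y : Γ} (hx : x ∉ G) : x * y ∈ G ↔ y ∉ G := by
  rw [Subgroup.mul_mem_iff_of_index_two (Fact.out : G.index = 2)]
  tauto

theorem mul_inv_mem {w z : Γ} (hw : w ∉ G) (hz : z ∉ G) : z * w⁻¹ ∈ G := by
  rw [mul_mem_iff_of_notMem hz, inv_mem_iff]; exact hw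

/-- An antilinear map, seen as a real linear map. -/
def realLinear (J : V →ₛₗ[starRingEnd ℂ] V) : Module.End ℝ V where
  toFun := J
  map_add' := map_add J
  map_smul' r v := by
    rw [← Complex.coe_smul, LinearMap.map_smulₛₗ, Complex.conj_ofReal, RingHom.id_apply,
      Complex.coe_smul]

open Classical in
-- Let `g w` act as `g J`. Twistedness handles the products odd times even; `J² = w²` is what odd
-- times odd requires.
theorem IsTwisted.isRealisable {J : V →ₛₗ[starRingEnd ℂ] V} (hw : w ∉ G) (hJ : IsTwisted w ρ J)
    (h : ∀ v, J (J v) = ρ (sq w) v) : IsRealisable ρ := by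
  let φ (z : Γ) : Module.End ℝ V :=
    if hz : z ∈ G then (ρ ⟨z, hz⟩).restrictScalars ℝ
    else (ρ ⟨z * w⁻¹, mul_inv_mem hw hz⟩).restrictScalars ℝ * realLinear J
  have hφ (g : G) (v : V) : φ g v = ρ g v := by simp [φ]
  have hφ' (g : G) (v : V) : φ (g * w) v = ρ g (J v) := by
    have : (g : Γ) * w ∉ G := by
      rw [Subgroup.mul_mem_iff_of_index_two (Fact.out : G.index = 2)]; simp [hw]
    simp [φ, this]
    rfl
  have hdec (z : Γ) : (∃ g : G, z = g) ∨ ∃ g : G, z = g * w := by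
    by_cases hz : z ∈ G
    · exact .inl ⟨⟨z, hz⟩, rfl⟩
    · exact .inr ⟨⟨z * w⁻¹, mul_inv_mem hw hz⟩, by simp⟩
  have hwg (g : G) : w * (g : Γ) = (MulAut.conjNormal w g : G) * w := by
    simp [MulAut.conjNormal_apply]
  refine ⟨⟨⟨⟨φ, ?_⟩, fun x y => ?_⟩, fun z c v => ?_⟩, ?_⟩
  · ext v
    have := hφ 1 v
    simpa using this
  · ext v
    simp only [Module.End.mul_apply]
    obtain ⟨g, rfl⟩ | ⟨g, rfl⟩ := hdec x <;> obtain ⟨k, rfl⟩ | ⟨k, rfl⟩ := hdec y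
    · rw [← Subgroup.coe_mul, hφ, hφ, hφ, map_mul, Module.End.mul_apply]
    · rw [← mul_assoc, ← Subgroup.coe_mul, hφ', hφ, hφ', map_mul, Module.End.mul_apply]
    · rw [mul_assoc, hwg, ← mul_assoc, ← Subgroup.coe_mul, hφ', hφ', hφ, hJ, map_mul,
        Module.End.mul_apply]
    · have : (g * w * (k * w) : Γ) = (g * MulAut.conjNormal w k * sq w : G) := by
        simp [MulAut.conjNormal_apply, sq, pow_two, mul_assoc]
      rw [this, hφ, hφ', hφ', hJ, h, map_mul, map_mul, Module.End.mul_apply, Module.End.mul_apply]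
  · change φ z (c • v) = twist G z c • φ z v
    obtain ⟨g, rfl⟩ | ⟨g, rfl⟩ := hdec z
    · rw [hφ, hφ, twist_of_mem G g.2, map_smul]; rfl
    · rw [hφ', hφ', twist_mul, twist_of_mem G g.2, twist_of_notMem G hw, LinearMap.map_smulₛₗ,
        map_smul]; rfl
  · ext g v
    exact hφ g v

/-- The action of an odd element, as an antilinear map. -/
def ARep.odd {W : Type*} [AddCommGroup W] [Module ℂ W] (σ : ARep G W) {z : Γ} (hz : z ∉ G) :
    W →ₛₗ[starRingEnd ℂ] W where
  toFun := σ.ρ z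
  map_add' := map_add (σ.ρ z)
  map_smul' c v := by rw [σ.map_smul', twist_of_notMem G hz]

theorem ARep.isTwisted_odd {W : Type*} [AddCommGroup W] [Module ℂ W] (σ : ARep G W)
    (hw : w ∉ G) : IsTwisted w σ.res (σ.odd hw) := fun g v => by
  change σ.ρ w (σ.ρ g v) = σ.ρ (MulAut.conjNormal w g : G) (σ.ρ w v)
  rw [← σ.mul_apply, ← σ.mul_apply, MulAut.conjNormal_apply]
  simp

theorem ARep.odd_odd {W : Type*} [AddCommGroup W] [Module ℂ W] (σ : ARep G W)
    (hw : w ∉ G) (v : W) : σ.odd hw (σ.odd hw v) = σ.res (sq w) v := by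
  change σ.ρ w (σ.ρ w v) = σ.ρ (w ^ 2) v
  rw [← σ.mul_apply, pow_two]

theorem IsRealisable.exists_isTwisted (hw : w ∉ G) (h : IsRealisable ρ) :
    ∃ J, IsTwisted w ρ J ∧ ∀ v, J (J v) = ρ (sq w) v := by
  obtain ⟨σ, rfl⟩ := h
  exact ⟨σ.odd hw, σ.isTwisted_odd hw, σ.odd_odd hw⟩

end Realisable

end GradedGroup

/-! ### An invariant Hermitian form -/

section Forms

variable {H : Type*} [Group H] {V : Type*} [AddCommGroup V] [Module ℂ V]

/-- The standard Hermitian form of a basis is summed over the group; the term at `1` keeps it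
positive definite. -/
theorem exists_invariant_sesquilinear [Finite H] [FiniteDimensional ℂ V]
    (ρ : Representation ℂ H V) : ∃ h : V →ₛₗ[starRingEnd ℂ] V →ₗ[ℂ] ℂ,
      (∀ g u v, h (ρ g u) (ρ g v) = h u v) ∧ ∀ u, u ≠ 0 → ∃ r : ℝ, 0 < r ∧ h u u = r := by
  have := Fintype.ofFinite H
  let b := Module.finBasis ℂ V
  let h₀ : V →ₛₗ[starRingEnd ℂ] V →ₗ[ℂ] ℂ :=
    LinearMap.mk₂'ₛₗ (starRingEnd ℂ) (RingHom.id ℂ)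
      (fun u v => ∑ g : H, ∑ i, conj (b.repr (ρ g u) i) * b.repr (ρ g v) i)
      (fun _ _ _ => by simp [add_mul, Finset.sum_add_distrib])
      (fun _ _ _ => by simp [Finset.mul_sum, mul_assoc])
      (fun _ _ _ => by simp [mul_add, Finset.sum_add_distrib])
      (fun _ _ _ => by simp [Finset.mul_sum, mul_left_comm])
  have hh (u v : V) : h₀ u v = ∑ g : H, ∑ i, conj (b.repr (ρ g u) i) * b.repr (ρ g v) i := rfl
  refine ⟨h₀, fun g u v => ?_, fun u hu => ?_⟩
  · rw [hh, hh]
    simp only [← Module.End.mul_apply, ← map_mul]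
    exact Fintype.sum_equiv (Equiv.mulRight g) _ _ fun _ => rfl
  · refine ⟨∑ g : H, ∑ i, Complex.normSq (b.repr (ρ g u) i), ?_, ?_⟩
    · have hnn (g : H) : 0 ≤ ∑ i, Complex.normSq (b.repr (ρ g u) i) :=
        Finset.sum_nonneg fun i _ => Complex.normSq_nonneg _
      refine Finset.sum_pos' (fun g _ => hnn g) ⟨1, Finset.mem_univ _, ?_⟩
      have hne : b.repr u ≠ 0 := (map_ne_zero_iff b.repr b.repr.injective).2 hu
      obtain ⟨i, hi⟩ := Finsupp.ne_iff.1 hne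
      refine Finset.sum_pos' (fun i _ => Complex.normSq_nonneg _) ⟨i, Finset.mem_univ _, ?_⟩
      simpa [Complex.normSq_pos] using hi
    · rw [hh]
      push_cast
      simp only [Complex.normSq_eq_conj_mul_self]

end Forms

/-! ### `w`-invariant bilinear forms -/

section GradedGroup

variable {Γ : Type*} [Group Γ] {G : Subgroup Γ} {V : Type*} [AddCommGroup V] [Module ℂ V]
  [Fact (G.index = 2)] {w : Γ} {ρ : Representation ℂ G V}

/-- The bilinear form `h(J u, v)`. -/
def twistedForm (h : V →ₛₗ[starRingEnd ℂ] V →ₗ[ℂ] ℂ) (J : V →ₛₗ[starRingEnd ℂ] V) :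
    LinearMap.BilinForm ℂ V := h.comp J

/-- Definiteness and a dimension count make `h` an isomorphism from `V̄` to the dual of `V`; then `J
= h⁻¹ ∘ B`, and invariance of `B` becomes twistedness of `J`. -/
theorem exists_form_eq [FiniteDimensional ℂ V] {h : V →ₛₗ[starRingEnd ℂ] V →ₗ[ℂ] ℂ}
    (hinv : ∀ (g : G) u v, h (ρ g u) (ρ g v) = h u v) (hpos : ∀ u, u ≠ 0 → h u u ≠ 0)
    {B : LinearMap.BilinForm ℂ V} (hB : IsInvariantForm w ρ B) :
    ∃ J, IsTwisted w ρ J ∧ B = twistedForm h J := by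
  have hinj : Function.Injective h := (injective_iff_map_eq_zero h).2 fun u hu => by
    by_contra h0
    exact hpos u h0 (by rw [hu, LinearMap.zero_apply])
  let h' : Conj V →ₗ[ℂ] Module.Dual ℂ V :=
    { toFun := fun v => h (show V from v)
      map_add' := fun a b => map_add h _ _
      map_smul' := fun c v => by
        change h ((conj c) • (show V from v) : V) = c • h (show V from v)
        rw [LinearMap.map_smulₛₗ, Complex.conj_conj] }
  have hsurj : Function.Surjective h' :=
    (LinearMap.injective_iff_surjective_of_finrank_eq_finrank
      (by rw [finrank_conj, Subspace.dual_finrank_eq])).1 hinj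
  let e := LinearEquiv.ofBijective h' ⟨hinj, hsurj⟩
  let J := ofConj (e.symm.toLinearMap ∘ₗ B)
  have hJ (u : V) : h (J u) = B u := e.apply_symm_apply (B u)
  refine ⟨J, fun g v => hinj (LinearMap.ext fun x => ?_), LinearMap.ext fun u => (hJ u).symm⟩
  obtain ⟨y, rfl⟩ : ∃ y, ρ (MulAut.conjNormal w g) y = x := ⟨_, rep_self_apply_inv ρ _ x⟩
  rw [hJ, hB, hinv, hJ]

theorem isInvariantForm_twistedForm {h : V →ₛₗ[starRingEnd ℂ] V →ₗ[ℂ] ℂ}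
    (hinv : ∀ (g : G) u v, h (ρ g u) (ρ g v) = h u v) {J : V →ₛₗ[starRingEnd ℂ] V}
    (hJ : IsTwisted w ρ J) : IsInvariantForm w ρ (twistedForm h J) := fun g u v => by
  change h (J (ρ g u)) _ = h (J u) v
  rw [hJ, hinv]

/-- As invariant forms are unique up to scalar, this operation multiplies a nonzero one by a
constant, which is its symmetry type. -/
theorem isInvariantForm_flip_sq {B : LinearMap.BilinForm ℂ V} (hB : IsInvariantForm w ρ B) :
    IsInvariantForm w ρ ((B.compl₂ (ρ (sq w))).flip) := fun g u v => by
  simp only [LinearMap.flip_apply, LinearMap.compl₂_apply]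
  rw [← hB (MulAut.conjNormal w g) v (ρ (sq w) u), ← Module.End.mul_apply (ρ (sq w)), ← map_mul,
    ← conjNormal_conjNormal_mul_sq, map_mul, Module.End.mul_apply]

theorem form_eq_smul [Finite G] [FiniteDimensional ℂ V] (hρ : ρ.IsIrreducible)
    {B B' : LinearMap.BilinForm ℂ V} (hB : IsInvariantForm w ρ B) (hB' : IsInvariantForm w ρ B')
    (h0 : B ≠ 0) : ∃ c : ℂ, B' = c • B := by
  obtain ⟨h, hinv, hpos⟩ := exists_invariant_sesquilinear ρ
  have hpos' : ∀ u, u ≠ 0 → h u u ≠ 0 := fun u hu h0 => by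
    obtain ⟨r, hr, hr'⟩ := hpos u hu
    rw [h0] at hr'
    exact hr.ne (by exact_mod_cast hr')
  obtain ⟨J, hJ, rfl⟩ := exists_form_eq hinv hpos' hB
  obtain ⟨J', hJ', rfl⟩ := exists_form_eq hinv hpos' hB'
  have hJ0 : J ≠ 0 := by
    rintro rfl
    exact h0 (LinearMap.ext fun u => map_zero h)
  obtain ⟨c, rfl⟩ := hJ.eq_smul hJ' hρ hJ0
  refine ⟨conj c, LinearMap.ext fun u => ?_⟩
  exact LinearMap.map_smulₛₗ h c (J u)

theorem form_eq_zero [Finite G] [FiniteDimensional ℂ V]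
    (hne : ∀ J, IsTwisted w ρ J → J = 0)
    {B : LinearMap.BilinForm ℂ V} (hB : IsInvariantForm w ρ B) : B = 0 := by
  obtain ⟨h, hinv, hpos⟩ := exists_invariant_sesquilinear ρ
  obtain ⟨J, hJ, rfl⟩ := exists_form_eq hinv (fun u hu h0 => by
    obtain ⟨r, hr, hr'⟩ := hpos u hu
    rw [h0] at hr'
    exact hr.ne (by exact_mod_cast hr')) hB
  rw [hne J hJ]
  exact LinearMap.ext fun u => map_zero h

/-- If `J² = δ w²`, then a non-degenerate invariant form exists, and every invariant form has
symmetry type `δ`. -/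
theorem IsTwisted.forms [Finite G] [FiniteDimensional ℂ V] {J : V →ₛₗ[starRingEnd ℂ] V}
    (hJ : IsTwisted w ρ J) (hρ : ρ.IsIrreducible) {δ : ℝ} (hδ : δ = 1 ∨ δ = -1)
    (hJJ : ∀ v, J (J v) = (δ : ℂ) • ρ (sq w) v) :
    (∃ B, IsInvariantForm w ρ B ∧ B.Nondegenerate) ∧
      ∀ B, IsInvariantForm w ρ B → ∀ u v, B u (ρ (sq w) v) = δ * B v u := by
  obtain ⟨h, hinv, hpos⟩ := exists_invariant_sesquilinear ρ
  have := nontrivial_of_isIrreducible hρ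
  obtain ⟨v₀, hv₀⟩ := exists_ne (0 : V)
  have hδ0 : (δ : ℂ) ≠ 0 := by rcases hδ with rfl | rfl <;> simp
  have hinj : Function.Injective J := (injective_iff_map_eq_zero J).2 fun v hv => by
    have h1 := hJJ v
    rw [hv, map_zero, eq_comm, smul_eq_zero_iff_right hδ0] at h1
    rw [← rep_inv_apply_self ρ (sq w) v, h1, map_zero]
  have hJ0 : J ≠ 0 := by
    rintro rfl
    exact hv₀ (hinj rfl)
  have hh0 (u : V) (hu : u ≠ 0) : h u u ≠ 0 := by
    obtain ⟨r, hr, hr'⟩ := hpos u hu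
    rw [hr']; exact_mod_cast hr.ne'
  have hJne (u : V) (hu : u ≠ 0) : J u ≠ 0 := (map_ne_zero_iff J hinj).2 hu
  set B := twistedForm h J with hBdef
  have hBapp (u v : V) : B u v = h (J u) v := rfl
  have hB : IsInvariantForm w ρ B := isInvariantForm_twistedForm hinv hJ
  have hsep : ∀ u, (∀ v, B u v = 0) → u = 0 := fun u hu => by
    by_contra hu0
    exact hh0 _ (hJne u hu0) (hu (J u))
  have hB0 : B ≠ 0 := fun h => hv₀ (hsep v₀ fun v => by rw [h]; rfl)
  obtain ⟨ε, hε⟩ := form_eq_smul hρ hB (isInvariantForm_flip_sq hB) hB0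
  have hε' (u v : V) : B u (ρ (sq w) v) = ε * B v u := by
    have := LinearMap.congr_fun (LinearMap.congr_fun hε v) u
    simpa using this
  -- Using the symmetry twice turns `B(w² v₀, w² u)` into `ε² B(v₀, u)`, while invariance under `w²`
  -- gives `B(v₀, u)`.
  have hε2 : ε = 1 ∨ ε = -1 := by
    obtain ⟨u, hu⟩ : ∃ u, B v₀ u ≠ 0 := by
      by_contra! h
      exact hv₀ (hsep v₀ h)
    have h1 := hB (sq w) v₀ u
    rw [conjNormal_sq, hε', hε', ← mul_assoc] at h1
    exact mul_self_eq_one_iff.1 (mul_right_cancel₀ hu (h1.trans (one_mul _).symm))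
  -- The symmetry at `v₀` and `w⁻² J v₀` reads `h(J v₀, J v₀) = ε δ h(v₀, v₀)`; both values of `h`
  -- are positive, so the signs agree.
  have hεδ : ε = δ := by
    obtain ⟨r, hr, hr'⟩ := hpos v₀ hv₀
    obtain ⟨s, hs, hs'⟩ := hpos (J v₀) (hJne v₀ hv₀)
    have h1 := hε' v₀ (ρ (sq w)⁻¹ (J v₀))
    rw [rep_self_apply_inv, hBapp, hBapp, hJ, map_inv, conjNormal_sq, hJJ, map_smul,
      rep_inv_apply_self, LinearMap.map_smulₛₗ, Complex.conj_ofReal, LinearMap.smul_apply, hr', hs',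
      smul_eq_mul] at h1
    rcases hε2 with rfl | rfl <;> rcases hδ with rfl | rfl
    · simp
    · exfalso
      have : s = 1 * (-1 * r) := by exact_mod_cast h1
      linarith
    · exfalso
      have : s = -1 * (1 * r) := by exact_mod_cast h1
      linarith
    · simp
  refine ⟨⟨B, hB, ?_⟩, fun B' hB' u v => ?_⟩
  · have hsep' : ∀ u, (∀ v, B v u = 0) → u = 0 := fun u hu => hsep u fun v => by
      rw [← rep_self_apply_inv ρ (sq w) v, hε', hu, mul_zero]
    exact ⟨hsep, hsep'⟩
  · obtain ⟨c, rfl⟩ := form_eq_smul hρ hB hB' hB0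
    simp only [LinearMap.smul_apply, smul_eq_mul]
    rw [hε', hεδ, mul_left_comm]

/-! ### The Real Frobenius–Schur indicator -/

section Indicator

/-- Invariant forms are the equivariant maps to the dual of the twisted representation. -/
def formIntertwining {B : LinearMap.BilinForm ℂ V} (hB : IsInvariantForm w ρ B) :
    ρ.IntertwiningMap (twistRep w ρ).dual :=
  B.intertwiningMap_of_isIntertwiningMap _ _ fun g u => LinearMap.ext fun v => by
    obtain ⟨y, rfl⟩ : ∃ y, ρ (MulAut.conjNormal w g) y = v := ⟨_, rep_self_apply_inv ρ _ v⟩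
    rw [hB]
    change _ = B u (ρ (MulAut.conjNormal w g⁻¹) _)
    rw [map_inv, rep_inv_apply_self]

theorem isInvariantForm_of_intertwining (f : ρ.IntertwiningMap (twistRep w ρ).dual) :
    IsInvariantForm w ρ f.toLinearMap := fun g u v => by
  have h : f (ρ g u) = (twistRep w ρ).dual g (f u) :=
    Representation.IntertwiningMap.isIntertwining _ _ f g u
  change f (ρ g u) _ = f u v
  rw [h]
  change f u (ρ (MulAut.conjNormal w g⁻¹) _) = f u v
  rw [map_inv, rep_inv_apply_self]

theorem finrank_intertwining_eq_one [Finite G] [FiniteDimensional ℂ V]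
    (hρ : ρ.IsIrreducible) {B : LinearMap.BilinForm ℂ V} (hB : IsInvariantForm w ρ B)
    (h0 : B ≠ 0) : Module.finrank ℂ (ρ.IntertwiningMap (twistRep w ρ).dual) = 1 := by
  refine finrank_eq_one (formIntertwining hB) (fun h => h0 ?_) fun f => ?_
  · exact congrArg Representation.IntertwiningMap.toLinearMap h
  · obtain ⟨c, hc⟩ := form_eq_smul hρ hB (isInvariantForm_of_intertwining f) h0
    exact ⟨c, Representation.IntertwiningMap.ext hc.symm⟩

/-- Character orthogonality for `V` and the dual of its twist, reindexed by `g ↦ g⁻¹`. -/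
theorem sum_character_mul [Fintype G] [FiniteDimensional ℂ V] :
    (Nat.card G : ℂ)⁻¹ * ∑ g : G, ρ.character g * ρ.character (MulAut.conjNormal w g) =
      Module.finrank ℂ (ρ.IntertwiningMap (twistRep w ρ).dual) := by
  have : Invertible (Nat.card G : ℂ) := invertibleOfNonzero (by simp)
  rw [← Representation.card_inv_mul_sum_char_mul_char_eq_finrank]
  congr 1
  refine Fintype.sum_equiv (Equiv.inv G) _ _ fun g => ?_
  rw [Representation.char_dual, mul_comm]
  simp only [Equiv.inv_apply, inv_inv]
  rfl

open Classical in
-- Every odd element is `z = g w` for a unique `g`, and `z² = g (w g w⁻¹) w²`.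
theorem indicator_eq [Fintype Γ] [Fintype G] (hw : w ∉ G) :
    indicator ρ = (Nat.card G : ℂ)⁻¹ *
      ∑ g : G, ρ.character (g * MulAut.conjNormal w g * sq w) := by
  rw [indicator]
  congr 1
  let e : {z : Γ // z ∉ G} ≃ G :=
    { toFun := fun z => ⟨z.1 * w⁻¹, mul_inv_mem hw z.2⟩
      invFun := fun g => ⟨g * w, fun h => by
        rw [Subgroup.mul_mem_iff_of_index_two (Fact.out : G.index = 2)] at h
        exact hw (h.1 g.2)⟩
      left_inv := fun z => by simp
      right_inv := fun g => by simp }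
  refine Fintype.sum_equiv e _ _ fun z => ?_
  congr 1
  ext
  simp [e, sq, MulAut.conjNormal_apply, pow_two, mul_assoc]

/-- If every invariant form has symmetry type `δ`, then the indicator is `δ` times the dimension
of the space of invariant forms. -/
theorem indicator_eq_mul_finrank [Fintype Γ] [FiniteDimensional ℂ V] (hw : w ∉ G) {δ : ℂ}
    (hδ : ∀ B, IsInvariantForm w ρ B → ∀ u v, B u (ρ (sq w) v) = δ * B v u) :
    indicator ρ = δ * Module.finrank ℂ (ρ.IntertwiningMap (twistRep w ρ).dual) := by
  have := Fintype.ofFinite G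
  rw [indicator_eq hw, ← sum_character_mul, mul_left_comm]
  congr 1
  let b := Module.finBasis ℂ V
  -- Averaging products of coordinate functions gives invariant forms, to which `hδ` applies. The
  -- sum of `χ(g (w g w⁻¹) w²)` is `∑ F i j (b j) (w² b i)`; the symmetry replaces each term by `δ F
  -- i j (b i) (b j)`, and these add up to a product of traces summed over `g`.
  let F (i j) : LinearMap.BilinForm ℂ V := LinearMap.mk₂ ℂ
    (fun u v => ∑ g : G, b.repr (ρ g u) i * b.repr (ρ (MulAut.conjNormal w g) v) j)
    (fun _ _ _ => by simp [add_mul, Finset.sum_add_distrib])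
    (fun _ _ _ => by simp [Finset.mul_sum, mul_assoc])
    (fun _ _ _ => by simp [mul_add, Finset.sum_add_distrib])
    (fun _ _ _ => by simp [Finset.mul_sum, mul_left_comm])
  have hFapp (i j) (u v : V) : F i j u v =
    ∑ g : G, b.repr (ρ g u) i * b.repr (ρ (MulAut.conjNormal w g) v) j := rfl
  have hF (i j) : IsInvariantForm w ρ (F i j) := fun g u v => by
    rw [hFapp, hFapp]
    simp only [← Module.End.mul_apply, ← map_mul]
    exact Fintype.sum_equiv (Equiv.mulRight g) _ _ fun _ => rfl
  have htr (f : V →ₗ[ℂ] V) : LinearMap.trace ℂ V f = ∑ i, b.repr (f (b i)) i := by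
    rw [LinearMap.trace_eq_matrix_trace ℂ b, Matrix.trace]
    simp [LinearMap.toMatrix_apply]
  calc ∑ g : G, ρ.character (g * MulAut.conjNormal w g * sq w)
      = ∑ g : G, ∑ i, ∑ j, b.repr (ρ g (b j)) i *
          b.repr (ρ (MulAut.conjNormal w g) (ρ (sq w) (b i))) j := by
        refine Finset.sum_congr rfl fun g _ => ?_
        rw [Representation.character, htr]
        refine Finset.sum_congr rfl fun i _ => ?_
        rw [map_mul, map_mul, Module.End.mul_apply, Module.End.mul_apply]
        generalize ρ (MulAut.conjNormal w g) (ρ (sq w) (b i)) = x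
        conv_lhs => rw [← b.sum_repr x]
        simp only [map_sum, map_smul, Finsupp.finsetSum_apply, Finsupp.smul_apply, smul_eq_mul]
        exact Finset.sum_congr rfl fun j _ => mul_comm _ _
    _ = ∑ i, ∑ j, F i j (b j) (ρ (sq w) (b i)) := by
        simp only [hFapp]
        rw [Finset.sum_comm]
        exact Finset.sum_congr rfl fun i _ => Finset.sum_comm
    _ = δ * ∑ i, ∑ j, F i j (b i) (b j) := by
        simp only [hδ _ (hF _ _), Finset.mul_sum]
    _ = δ * ∑ g : G, ρ.character g * ρ.character (MulAut.conjNormal w g) := by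
        congr 1
        simp only [hFapp, Representation.character, htr, Finset.sum_mul_sum]
        rw [Finset.sum_comm (s := (Finset.univ : Finset G))]
        exact Finset.sum_congr rfl fun i _ => Finset.sum_comm

end Indicator

end GradedGroup

/-! ### The decomposition of `W` and the algebra `End_A(W)` -/

section GradedGroup

variable {Γ : Type*} [Group Γ] {G : Subgroup Γ} {W : Type*} [AddCommGroup W] [Module ℂ W]
  {σ : ARep G W}

theorem ARep.smul_of_notMem (σ : ARep G W) {z : Γ} (hz : z ∉ G) (c : ℂ) (v : W) :
    σ.ρ z (c • v) = conj c • σ.ρ z v := by rw [σ.map_smul', twist_of_notMem G hz]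

theorem ARep.inv_apply_self (σ : ARep G W) (z : Γ) (v : W) : σ.ρ z⁻¹ (σ.ρ z v) = v := by
  rw [← σ.mul_apply]; simp

theorem ARep.self_apply_inv (σ : ARep G W) (z : Γ) (v : W) : σ.ρ z (σ.ρ z⁻¹ v) = v := by
  rw [← σ.mul_apply]; simp

/-- The finite orbit of a nonzero vector spans an A-subrepresentation. -/
theorem ARep.IsIrreducible.finiteDimensional [Finite Γ] (hσ : σ.IsIrreducible) :
    FiniteDimensional ℂ W := by
  obtain ⟨h0, hσ⟩ := hσ
  obtain ⟨v, hv⟩ := exists_ne (0 : W)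
  have htop : Submodule.span ℂ (Set.range fun z => σ.ρ z v) = ⊤ := by
    refine (hσ _ fun z x hx => ?_).resolve_left fun h => hv ?_
    · induction hx using Submodule.span_induction with
      | mem x hx =>
        obtain ⟨y, rfl⟩ := hx
        exact Submodule.subset_span ⟨z * y, σ.mul_apply z y v⟩
      | zero => rw [map_zero]; exact Submodule.zero_mem _
      | add x y _ _ hx hy => rw [map_add]; exact Submodule.add_mem _ hx hy
      | smul c x _ hx => rw [σ.map_smul']; exact Submodule.smul_mem _ _ hx
    · rw [Submodule.eq_bot_iff] at h
      exact h v (Submodule.subset_span ⟨1, by simp⟩)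
  exact ⟨htop ▸ Submodule.fg_span (Set.finite_range _)⟩

theorem nonempty_endA_algEquiv {A : Type*} [Semiring A] [Algebra ℝ A]
    (φ : A →ₐ[ℝ] Module.End ℂ W) (hinj : Function.Injective φ) (hφ : ∀ a, φ a ∈ σ.endA)
    (hsurj : ∀ f ∈ σ.endA, ∃ a, φ a = f) : Nonempty (σ.endA ≃ₐ[ℝ] A) := by
  refine ⟨(AlgEquiv.ofBijective (φ.codRestrict σ.endA hφ) ⟨fun a b h => ?_, fun f => ?_⟩).symm⟩
  · exact hinj (congrArg Subtype.val h)
  · obtain ⟨a, ha⟩ := hsurj f f.2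
    exact ⟨a, Subtype.ext ha⟩

theorem inv_notMem {w : Γ} (hw : w ∉ G) : w⁻¹ ∉ G := by rwa [inv_mem_iff]

/-- An endomorphism is a complex scalar by Schur's lemma, and commuting with the antilinear `w`
forces it to be real. -/
theorem endA_real [FiniteDimensional ℂ W] {w : Γ} (hw : w ∉ G) (h : σ.res.IsIrreducible) :
    Nonempty (σ.endA ≃ₐ[ℝ] ℝ) := by
  have := nontrivial_of_isIrreducible h
  obtain ⟨v, hv⟩ := exists_ne (0 : W)
  have hv' : σ.ρ w v ≠ 0 := fun h => hv (by rw [← σ.inv_apply_self w v, h, map_zero])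
  refine nonempty_endA_algEquiv (Algebra.ofId ℝ (Module.End ℂ W)) ?_ (fun r => ?_) fun f hf => ?_
  · exact FaithfulSMul.algebraMap_injective ℝ (Module.End ℂ W)
  · exact σ.endA.algebraMap_mem r
  · obtain ⟨c, hc⟩ := exists_eq_smul h f fun g v => hf g v
    have h1 : c • σ.ρ w v = conj c • σ.ρ w v := by
      rw [← hc, hf w v, hc, σ.smul_of_notMem hw]
    obtain ⟨r, rfl⟩ := Complex.conj_eq_iff_real.1 (smul_left_injective ℂ hv' h1).symm
    exact ⟨r, LinearMap.ext fun v => (Complex.coe_smul r v).symm.trans (hc v).symm⟩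

section Sum

variable {w : Γ} (hw : w ∉ G) (V : Subrepresentation σ.res)

/-- The map `V ⊕ w·V̄ → W`, `(u, v) ↦ u + w⁻¹ v`. -/
def oddSum : V.toSubmodule × Conj V.toSubmodule →ₗ[ℂ] W :=
  V.toSubmodule.subtype.coprod
    { toFun := fun v => σ.ρ w⁻¹ (show V.toSubmodule from v)
      map_add' := fun u v => map_add (σ.ρ w⁻¹) _ _
      map_smul' := fun c v => by
        change σ.ρ w⁻¹ (conj c • ((show V.toSubmodule from v) : W)) = _
        rw [σ.smul_of_notMem (inv_notMem hw), Complex.conj_conj]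
        rfl }

theorem oddSum_apply (u v : V.toSubmodule) : oddSum hw V (u, v) = u + σ.ρ w⁻¹ v := rfl

variable {hw V} {J : V.toSubmodule →ₛₗ[starRingEnd ℂ] V.toSubmodule}

/-- The isomorphism `V ⊕ V → W`, `(u, v) ↦ u + w⁻¹ J v`. -/
def quaternionicEquiv (h : Function.Bijective (oddSum hw V)) (hJ : Function.Bijective J) :
    (V.toSubmodule × V.toSubmodule) ≃ₗ[ℂ] W :=
  (LinearEquiv.prodCongr (LinearEquiv.refl ℂ _) (LinearEquiv.ofBijective (toConj J) hJ)).trans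
    (LinearEquiv.ofBijective _ h)

theorem quaternionicEquiv_apply (h : Function.Bijective (oddSum hw V)) (hJ : Function.Bijective J)
    (u v : V.toSubmodule) : quaternionicEquiv h hJ (u, v) = oddSum hw V (u, J v) := rfl

end Sum

variable [Fact (G.index = 2)] {w : Γ}

/-- Since `Γ = G ∪ G w`, it is enough to test `G` and `w`; likewise for commutation in
`comm_of_comm_odd`. -/
theorem forall_mem_of_mem_odd {U : Submodule ℂ W} (hw : w ∉ G)
    (hG : ∀ g : G, ∀ v ∈ U, σ.res g v ∈ U) (hU : ∀ v ∈ U, σ.ρ w v ∈ U) :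
    ∀ z, ∀ v ∈ U, σ.ρ z v ∈ U := fun z v hv => by
  by_cases hz : z ∈ G
  · exact hG ⟨z, hz⟩ v hv
  · have := hG ⟨z * w⁻¹, mul_inv_mem hw hz⟩ _ (hU v hv)
    change σ.ρ (z * w⁻¹) (σ.ρ w v) ∈ U at this
    rw [← σ.mul_apply] at this
    simpa using this

theorem comm_of_comm_odd (hw : w ∉ G) {f : Module.End ℂ W}
    (hG : ∀ (g : G) v, f (σ.res g v) = σ.res g (f v)) (hf : ∀ v, f (σ.ρ w v) = σ.ρ w (f v)) :
    f ∈ σ.endA := fun z v => by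
  by_cases hz : z ∈ G
  · exact hG ⟨z, hz⟩ v
  · have h := hG ⟨z * w⁻¹, mul_inv_mem hw hz⟩ (σ.ρ w v)
    change f (σ.ρ (z * w⁻¹) (σ.ρ w v)) = σ.ρ (z * w⁻¹) (f (σ.ρ w v)) at h
    rw [hf, ← σ.mul_apply, ← σ.mul_apply] at h
    simpa using h

section Sum

variable (hw : w ∉ G) (V : Subrepresentation σ.res)

theorem oddSum_comm (g : G) (x : V.toSubmodule × Conj V.toSubmodule) :
    oddSum hw V (V.toRepresentation.prod (twistRep w (conjRep V.toRepresentation)) g x) =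
      σ.res g (oddSum hw V x) := by
  obtain ⟨u, v⟩ := x
  change σ.ρ g (u : W) + σ.ρ w⁻¹ (σ.ρ (MulAut.conjNormal w g : G) (show V.toSubmodule from v)) =
    σ.ρ g (u + σ.ρ w⁻¹ (show V.toSubmodule from v))
  rw [map_add, ← σ.mul_apply, ← σ.mul_apply, MulAut.conjNormal_apply]
  simp [mul_assoc]

theorem odd_oddSum (u v : V.toSubmodule) :
    σ.ρ w (oddSum hw V (u, v)) = oddSum hw V (v, V.toRepresentation (sq w) u) := by
  change σ.ρ w (u + σ.ρ w⁻¹ v) = v + σ.ρ w⁻¹ (σ.ρ (w ^ 2) u)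
  rw [map_add, σ.self_apply_inv, ← σ.mul_apply w⁻¹, add_comm]
  simp [pow_two]

variable {V}

/-- Irreducibility of `W` is used twice: on the image of the sum map, and on `U = V ∩ w⁻¹V`, which
contains `u` whenever `u + w⁻¹ v = 0`. -/
theorem eq_top_or_bijective_oddSum (hσ : σ.IsIrreducible)
    (hV : V.toRepresentation.IsIrreducible) :
    V.toSubmodule = ⊤ ∨ Function.Bijective (oddSum hw V) := by
  have := nontrivial_of_isIrreducible hV
  obtain ⟨v₀, hv₀⟩ := exists_ne (0 : V.toSubmodule)
  have hsurj : LinearMap.range (oddSum hw V) = ⊤ := by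
    refine (hσ.2 _ (forall_mem_of_mem_odd hw ?_ ?_)).resolve_left fun h => hv₀ ?_
    · rintro g _ ⟨x, rfl⟩
      exact ⟨_, oddSum_comm hw V g x⟩
    · rintro _ ⟨⟨u, v⟩, rfl⟩
      exact ⟨_, (odd_oddSum hw V u v).symm⟩
    · rw [LinearMap.range_eq_bot] at h
      have := LinearMap.congr_fun h (v₀, (0 : V.toSubmodule))
      rw [oddSum_apply] at this
      simpa using this
  let U : Submodule ℂ W :=
    { carrier := {x | x ∈ V.toSubmodule ∧ σ.ρ w x ∈ V.toSubmodule}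
      add_mem' := fun ha hb =>
        ⟨add_mem ha.1 hb.1, by rw [map_add]; exact add_mem ha.2 hb.2⟩
      zero_mem' := ⟨zero_mem _, by rw [map_zero]; exact zero_mem _⟩
      smul_mem' := fun c x hx =>
        ⟨Submodule.smul_mem _ _ hx.1, by rw [σ.map_smul']; exact Submodule.smul_mem _ _ hx.2⟩ }
  have hmem {x : W} (hx : x ∈ V.toSubmodule) (g : G) : σ.ρ g x ∈ V.toSubmodule :=
    V.apply_mem_toSubmodule g hx
  refine (hσ.2 U (forall_mem_of_mem_odd hw ?_ ?_)).symm.imp (fun h => ?_) fun h => ?_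
  · intro g x hx
    refine ⟨hmem hx.1 g, ?_⟩
    have := hmem hx.2 (MulAut.conjNormal w g)
    change σ.ρ w (σ.ρ g x) ∈ _
    rw [← σ.mul_apply, MulAut.conjNormal_apply] at this
    rw [← σ.mul_apply]
    simpa using this
  · intro x hx
    refine ⟨hx.2, ?_⟩
    rw [← σ.mul_apply, ← pow_two]
    exact hmem hx.1 (sq w)
  · rw [eq_top_iff] at h ⊢
    exact fun x hx => (h hx).1
  · refine ⟨(injective_iff_map_eq_zero _).2 ?_, LinearMap.range_eq_top.1 hsurj⟩
    rintro ⟨u, v⟩ huv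
    change (u : W) + σ.ρ w⁻¹ (show V.toSubmodule from v) = 0 at huv
    have hu : (u : W) ∈ U := by
      refine ⟨u.2, ?_⟩
      rw [eq_neg_of_add_eq_zero_left huv, map_neg, σ.self_apply_inv]
      exact neg_mem (show V.toSubmodule from v).2
    rw [h, Submodule.mem_bot] at hu
    rw [hu, zero_add] at huv
    have hv : ((show V.toSubmodule from v) : W) = 0 := by
      rw [← σ.self_apply_inv w (show V.toSubmodule from v), huv, map_zero]
    exact Prod.ext (Subtype.ext hu) (Subtype.ext hv)

variable {hw}

theorem not_isRealisable_of_injective (hσ : σ.IsIrreducible)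
    (hV : V.toRepresentation.IsIrreducible) (h : Function.Injective (oddSum hw V)) :
    ¬ IsRealisable V.toRepresentation := fun hR => by
  have := nontrivial_of_isIrreducible hV
  obtain ⟨v₀, hv₀⟩ := exists_ne (0 : V.toSubmodule)
  obtain ⟨J, hJ, hJJ⟩ := hR.exists_isTwisted hw
  have hJ0 (v) (hv : J v = 0) : v = 0 := by
    have := hJJ v
    rw [hv, map_zero] at this
    rw [← rep_inv_apply_self V.toRepresentation (sq w) v, ← this, map_zero]
  -- The image of the graph of `J` is stable under `w` because `w (v + w⁻¹ J v) = J v + w⁻¹ J (J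
  -- v)`. It is nonzero and misses `v₀`, against irreducibility of `W`.
  let f := oddSum hw V ∘ₗ LinearMap.prod LinearMap.id (toConj J)
  have hf (v) : f v = oddSum hw V (v, J v) := rfl
  have hU := forall_mem_of_mem_odd (σ := σ) (U := LinearMap.range f) hw ?_ ?_
  · rcases hσ.2 (LinearMap.range f) hU with h' | h'
    · rw [LinearMap.range_eq_bot] at h'
      have h1 : oddSum hw V (v₀, J v₀) = 0 := LinearMap.congr_fun h' v₀
      exact hv₀ (congrArg Prod.fst (h (h1.trans (map_zero _).symm)))
    · obtain ⟨u, hu⟩ := (LinearMap.range_eq_top.1 h') (oddSum hw V (v₀, (0 : V.toSubmodule)))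
      have h1 := h hu
      have hu1 : u = v₀ := congrArg Prod.fst h1
      have hu2 : J u = 0 := congrArg Prod.snd h1
      exact hv₀ (hu1 ▸ hJ0 u hu2)
  · rintro g _ ⟨v, rfl⟩
    refine ⟨V.toRepresentation g v, ?_⟩
    rw [hf, hf, hJ, ← oddSum_comm]
    rfl
  · rintro _ ⟨v, rfl⟩
    refine ⟨J v, ?_⟩
    rw [hf, hf, odd_oddSum, hJJ]

/-- A `G`-endomorphism is a pair of scalars `(c, d)` on `V ⊕ w·V̄`. As `w` interchanges the summands
antilinearly, commuting with it means `d = c̄`, leaving one free complex number. -/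
theorem endA_complex [FiniteDimensional ℂ W] (hV : V.toRepresentation.IsIrreducible)
    (h : Function.Bijective (oddSum hw V))
    (hne : ¬ Nonempty (V.toRepresentation.Equiv (twistRep w (conjRep V.toRepresentation)))) :
    Nonempty (σ.endA ≃ₐ[ℝ] ℂ) := by
  have := nontrivial_of_isIrreducible hV
  have hV' := isIrreducible_twistRep_conjRep hV w
  have := nontrivial_of_isIrreducible hV'
  let e := LinearEquiv.ofBijective _ h
  let D := diagEnd V.toSubmodule (Conj V.toSubmodule)
  let φ : ℂ →ₐ[ℝ] Module.End ℂ W :=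
    (e.conjAlgEquiv ℝ).toAlgHom.comp ((D.restrictScalars ℝ).comp
      ((AlgHom.id ℝ ℂ).prod Complex.conjAe.toAlgHom))
  have hconj (f x) : e.conjAlgEquiv ℝ f (e x) = e (f x) := by
    simp [LinearEquiv.conjAlgEquiv]
  have hφ (c : ℂ) (x) : φ c (e x) = e (D (c, conj c) x) := hconj _ x
  let E (u v : V.toSubmodule) : W := oddSum hw V (u, v)
  have hE (x) : ∃ u v, E u v = x := by
    obtain ⟨⟨u, v⟩, rfl⟩ := e.surjective x
    exact ⟨u, v, rfl⟩
  have hE' {u v u' v'} (h : E u v = E u' v') : u = u' := congrArg Prod.fst (e.injective h)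
  have hw' (u v) : σ.ρ w (E u v) = E v (V.toRepresentation (sq w) u) := odd_oddSum hw V u v
  have hG (g : G) x : e (V.toRepresentation.prod (twistRep w (conjRep V.toRepresentation)) g x) =
    σ.res g (e x) := oddSum_comm hw V g x
  have hφ' (c u v) : φ c (E u v) = E (c • u) (c • v) := by
    refine (hφ c _).trans ?_
    change E (c • u) (conj (conj c) • v) = _
    rw [Complex.conj_conj]
  refine nonempty_endA_algEquiv φ (fun c d hcd => ?_) (fun c => ?_) fun f hf => ?_
  · have : D (c, conj c) = D (d, conj d) := LinearMap.ext fun x => e.injective (by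
      rw [← hφ, ← hφ, hcd])
    exact congrArg Prod.fst (diagEnd_injective this)
  · refine comm_of_comm_odd hw (fun g x => ?_) fun x => ?_
    · obtain ⟨x, rfl⟩ := e.surjective x
      rw [← hG, hφ, hφ, ← hG, diagEnd_comm]
    · obtain ⟨u, v, rfl⟩ := hE x
      rw [hw', hφ', hφ', hw', map_smul]
  · obtain ⟨c, hc⟩ := exists_diagEnd_eq hV hV' hne (e.symm.conj f) fun g x => e.injective (by
      simp only [LinearEquiv.conj_apply, LinearMap.comp_apply, LinearEquiv.coe_coe,
        LinearEquiv.symm_symm, LinearEquiv.apply_symm_apply, hG]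
      exact hf g _)
    have hc' (x) : f (e x) = e (D c x) := by
      rw [show D c = _ from hc]
      simp [LinearEquiv.conj_apply]
    obtain ⟨v, hv⟩ := exists_ne (0 : V.toSubmodule)
    have hc'' (u v) : f (E u v) = E (c.1 • u) (conj c.2 • v) := hc' _
    -- `w` carries `(0, v)` to `(v, 0)`, so this compares the two scalars on the same vector.
    have h1 := hf w (E 0 v)
    rw [hw', hc'', hc'', hw'] at h1
    have h2 : c.1 • v = conj c.2 • v := hE' h1
    have h3 : c.2 = conj c.1 := by
      rw [smul_left_injective ℂ hv h2, Complex.conj_conj]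
    refine ⟨c.1, LinearMap.ext fun x => ?_⟩
    obtain ⟨x, rfl⟩ := e.surjective x
    rw [hφ, hc', ← h3]

/-- The embedding of the quaternions into complex matrices. -/
def quaternionMatrix : ℍ[ℝ] →ₐ[ℝ] Matrix (Fin 2) (Fin 2) ℂ where
  toFun q := !![⟨q.re, q.imI⟩, ⟨q.imJ, q.imK⟩; ⟨-q.imJ, q.imK⟩, ⟨q.re, -q.imI⟩]
  map_one' := by
    ext i j
    fin_cases i <;> fin_cases j <;> simp [Complex.ext_iff]
  map_mul' p q := by
    ext i j
    fin_cases i <;> fin_cases j <;>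
      simp [Matrix.mul_apply, Fin.sum_univ_two, Complex.ext_iff] <;> constructor <;> ring
  map_zero' := by
    ext i j
    fin_cases i <;> fin_cases j <;> simp [Complex.ext_iff]
  map_add' p q := by
    ext i j
    fin_cases i <;> fin_cases j <;> simp [Complex.ext_iff] <;> ring
  commutes' r := by
    ext i j
    fin_cases i <;> fin_cases j <;>
      simp [Complex.ext_iff, Matrix.algebraMap_matrix_apply]

theorem quaternionMatrix_injective : Function.Injective quaternionMatrix := fun p q h => by
  have h₀ := congrFun (congrFun h 0) 0
  have h₁ := congrFun (congrFun h 0) 1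
  simp only [quaternionMatrix, AlgHom.coe_mk, RingHom.coe_mk, MonoidHom.coe_mk, OneHom.coe_mk,
    Matrix.of_apply, Matrix.cons_val', Matrix.cons_val_zero, Matrix.cons_val_one,
    Matrix.cons_val_fin_one, Complex.mk.injEq] at h₀ h₁
  exact Quaternion.ext p q h₀.1 h₀.2 h₁.1 h₁.2

theorem quaternionMatrix_entries (q : ℍ[ℝ]) :
    quaternionMatrix q 1 0 = -conj (quaternionMatrix q 0 1) ∧
      quaternionMatrix q 1 1 = conj (quaternionMatrix q 0 0) := by
  simp [quaternionMatrix, Complex.ext_iff]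

theorem exists_quaternionMatrix_eq {M : Matrix (Fin 2) (Fin 2) ℂ} (h₁₀ : M 1 0 = -conj (M 0 1))
    (h₁₁ : M 1 1 = conj (M 0 0)) : ∃ q, quaternionMatrix q = M := by
  refine ⟨⟨(M 0 0).re, (M 0 0).im, (M 0 1).re, (M 0 1).im⟩, ?_⟩
  ext i j
  fin_cases i <;> fin_cases j <;> simp [quaternionMatrix, h₁₀, h₁₁, Complex.ext_iff]

section Quaternionic

variable {J : V.toSubmodule →ₛₗ[starRingEnd ℂ] V.toSubmodule}

theorem quaternionicEquiv_comm (h : Function.Bijective (oddSum hw V)) (hJ : Function.Bijective J)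
    (hJw : IsTwisted w V.toRepresentation J) (g : G) (x : V.toSubmodule × V.toSubmodule) :
    quaternionicEquiv h hJ (V.toRepresentation.prod V.toRepresentation g x) =
      σ.res g (quaternionicEquiv h hJ x) := by
  obtain ⟨u, v⟩ := x
  exact (congrArg (fun y : V.toSubmodule => oddSum hw V (V.toRepresentation g u, y))
    (hJw g v)).trans (oddSum_comm hw V g (u, J v))

/-- The sign in `J² = -w²` absorbs `w²` and turns `w` into the standard quaternionic structure on `V
⊕ V`. -/
theorem odd_quaternionicEquiv (h : Function.Bijective (oddSum hw V)) (hJ : Function.Bijective J)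
    (hJJ : ∀ v, J (J v) = -V.toRepresentation (sq w) v) (u v : V.toSubmodule) :
    σ.ρ w (quaternionicEquiv h hJ (u, v)) = quaternionicEquiv h hJ (J v, -J u) := by
  rw [quaternionicEquiv_apply, quaternionicEquiv_apply, odd_oddSum, map_neg, hJJ, neg_neg]

/-- The complex matrices commuting with `(u, v) ↦ (J v, -J u)` are those whose second row is `(-b̄,
ā)` when the first is `(a, b)`: the standard copy of ℍ. -/
theorem endA_quaternion [FiniteDimensional ℂ W] (hV : V.toRepresentation.IsIrreducible)
    (h : Function.Bijective (oddSum hw V)) (hJ : Function.Bijective J)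
    (hJw : IsTwisted w V.toRepresentation J)
    (hJJ : ∀ v, J (J v) = -V.toRepresentation (sq w) v) :
    Nonempty (σ.endA ≃ₐ[ℝ] ℍ[ℝ]) := by
  have := nontrivial_of_isIrreducible hV
  set e := quaternionicEquiv h hJ
  have hw' (u v : V.toSubmodule) : σ.ρ w (e (u, v)) = e (J v, -J u) :=
    odd_quaternionicEquiv h hJ hJJ u v
  have hG (g : G) x : e (V.toRepresentation.prod V.toRepresentation g x) = σ.res g (e x) :=
    quaternionicEquiv_comm h hJ hJw g x
  let D := matrixEnd V.toSubmodule
  let φ : ℍ[ℝ] →ₐ[ℝ] Module.End ℂ W :=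
    (e.conjAlgEquiv ℝ).toAlgHom.comp ((D.restrictScalars ℝ).comp quaternionMatrix)
  have hconj (f x) : e.conjAlgEquiv ℝ f (e x) = e (f x) := by
    simp [LinearEquiv.conjAlgEquiv]
  have hφ (q) (x) : φ q (e x) = e (D (quaternionMatrix q) x) := hconj _ x
  refine nonempty_endA_algEquiv φ (fun c d hcd => ?_) (fun q => ?_) fun f hf => ?_
  · have : D (quaternionMatrix c) = D (quaternionMatrix d) :=
      LinearMap.ext fun x => e.injective (by rw [← hφ, ← hφ, hcd])
    exact quaternionMatrix_injective (matrixEnd_injective this)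
  · refine comm_of_comm_odd hw (fun g x => ?_) fun x => ?_
    · obtain ⟨x, rfl⟩ := e.surjective x
      rw [← hG, hφ, hφ, ← hG, matrixEnd_comm]
    · obtain ⟨⟨u, v⟩, rfl⟩ := e.surjective x
      obtain ⟨h₁₀, h₁₁⟩ := quaternionMatrix_entries q
      rw [hw', hφ, hφ, matrixEnd_apply, matrixEnd_apply, hw', h₁₀, h₁₁]
      simp only [map_add, LinearMap.map_smulₛₗ, map_neg, Complex.conj_conj]
      congr 1
      ext <;> simp [add_comm]
  · obtain ⟨M, hM⟩ := exists_matrixEnd_eq hV (e.symm.conj f) fun g x => e.injective (by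
      simp only [LinearEquiv.conj_apply, LinearMap.comp_apply, LinearEquiv.coe_coe,
        LinearEquiv.symm_symm, LinearEquiv.apply_symm_apply, hG]
      exact hf g _)
    have hM' (x) : f (e x) = e (D M x) := by
      rw [show D M = _ from hM]
      simp [LinearEquiv.conj_apply]
    obtain ⟨v, hv⟩ := exists_ne (0 : V.toSubmodule)
    have hv' : J v ≠ 0 := (map_ne_zero_iff J hJ.1).2 hv
    -- The two components of this single equation give both conditions on the second row.
    have h1 := hf w (e (v, 0))
    rw [hw', hM', hM', matrixEnd_apply, matrixEnd_apply, hw'] at h1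
    have h2 := e.injective h1
    simp only [map_zero, smul_zero, zero_add, add_zero, smul_neg, LinearMap.map_smulₛₗ,
      Prod.mk.injEq, neg_inj] at h2
    obtain ⟨q, rfl⟩ := exists_quaternionMatrix_eq (M := M)
      (by
        have h3 : -M 0 1 = conj (M 1 0) := smul_left_injective ℂ hv' (by simpa using h2.1)
        rw [← Complex.conj_conj (M 1 0), ← h3, map_neg])
      (smul_left_injective ℂ hv' h2.2)
    refine ⟨q, LinearMap.ext fun x => ?_⟩
    obtain ⟨x, rfl⟩ := e.surjective x
    rw [hφ, hM']

end Quaternionic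

end Sum

end GradedGroup

/-! ### The induced A-representation -/

section GradedGroup

variable {Γ : Type*} [Group Γ] {G : Subgroup Γ} [Fact (G.index = 2)] {w : Γ}
  {V : Type*} [AddCommGroup V] [Module ℂ V] {ρ : Representation ℂ G V}
  {X : Type*} [AddCommGroup X] [Module ℂ X]

/-- The action of the skew group algebra on an A-representation. -/
def skewAction (τ : ARep G X) : SkewGroupAlgebra G →+* Module.End ℝ X :=
  letI := twistAction G
  SkewMonoidAlgebra.liftNCRingHom (Algebra.lsmul ℝ ℝ X : ℂ →ₐ[ℝ] Module.End ℝ X).toRingHom τ.ρ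
    fun {c z} => LinearMap.ext fun v => (τ.map_smul' z c v).symm

theorem skewAction_single (τ : ARep G X) (z : Γ) (c : ℂ) (v : X) :
    skewAction τ (.single z c) v = c • τ.ρ z v :=
  letI := twistAction G
  LinearMap.congr_fun (SkewMonoidAlgebra.liftNC_single
    ((Algebra.lsmul ℝ ℝ X : ℂ →ₐ[ℝ] Module.End ℝ X).toRingHom : ℂ →+ Module.End ℝ X)
    τ.ρ z c) v

theorem SkewGroupAlgebra.induction {p : SkewGroupAlgebra G → Prop} (s : SkewGroupAlgebra G)
    (zero : p 0) (single : ∀ z c, p (.single z c)) (add : ∀ s t, p s → p t → p (s + t)) : p s :=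
  SkewMonoidAlgebra.induction_on (p := p) s zero single add

namespace Induced

variable (ρ) in
/-- The pure tensor `s ⊗ v`. -/
def tmul (s : SkewGroupAlgebra G) (v : V) : Induced ρ :=
  (balancedRelations ρ).mkQ (s ⊗ₜ[ℤ] v)

theorem tmul_add (s : SkewGroupAlgebra G) (u v : V) : tmul ρ s (u + v) = tmul ρ s u + tmul ρ s v :=
  (congrArg (balancedRelations ρ).mkQ (TensorProduct.tmul_add s u v)).trans (map_add _ _ _)

theorem add_tmul (s t : SkewGroupAlgebra G) (v : V) : tmul ρ (s + t) v = tmul ρ s v + tmul ρ t v :=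
  (congrArg (balancedRelations ρ).mkQ (TensorProduct.add_tmul s t v)).trans (map_add _ _ _)

theorem tmul_zero (s : SkewGroupAlgebra G) : tmul ρ s 0 = 0 :=
  (congrArg (balancedRelations ρ).mkQ (TensorProduct.tmul_zero V s)).trans (map_zero _)

theorem zero_tmul (v : V) : tmul ρ 0 v = 0 :=
  (congrArg (balancedRelations ρ).mkQ (TensorProduct.zero_tmul _ v)).trans (map_zero _)

theorem mul_single_tmul (s : SkewGroupAlgebra G) (g : G) (c : ℂ) (v : V) :
    tmul ρ (s * .single (g : Γ) c) v = tmul ρ s (c • ρ g v) := by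
  refine (Submodule.Quotient.eq _).2 (Submodule.subset_span ⟨s, c, g, v, rfl⟩)

theorem induction {p : Induced ρ → Prop} (x : Induced ρ)
    (tmul : ∀ s v, p (tmul ρ s v)) (add : ∀ x y, p x → p y → p (x + y)) : p x := by
  obtain ⟨y, rfl⟩ := Submodule.mkQ_surjective (balancedRelations ρ) x
  induction y using TensorProduct.induction_on with
  | zero =>
    rw [map_zero]
    have := tmul 0 0
    rwa [tmul_zero] at this
  | tmul s v => exact tmul s v
  | add x y hx hy => rw [map_add]; exact add _ _ hx hy

/-- As `Γ = G ∪ w⁻¹ G`, elements of `G` can be moved across the tensor sign. Uniqueness is not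
needed: in `ind_isIso` it follows from directness in the target. -/
theorem exists_eq (hw : w ∉ G) (x : Induced ρ) :
    ∃ u v, x = tmul ρ 1 u + tmul ρ (.single w⁻¹ 1) v := by
  have hadd {x y : Induced ρ} (hx : ∃ u v, x = tmul ρ 1 u + tmul ρ (.single w⁻¹ 1) v)
      (hy : ∃ u v, y = tmul ρ 1 u + tmul ρ (.single w⁻¹ 1) v) :
      ∃ u v, x + y = tmul ρ 1 u + tmul ρ (.single w⁻¹ 1) v := by
    obtain ⟨u, v, rfl⟩ := hx
    obtain ⟨u', v', rfl⟩ := hy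
    exact ⟨u + u', v + v', by rw [tmul_add, tmul_add]; abel⟩
  induction x using induction with
  | add x y hx hy => exact hadd hx hy
  | tmul s v =>
    induction s using SkewGroupAlgebra.induction with
    | zero => exact ⟨0, 0, by simp [tmul_zero, zero_tmul]⟩
    | add s t hs ht => rw [add_tmul]; exact hadd hs ht
    | single z c =>
      by_cases hz : z ∈ G
      · refine ⟨c • ρ ⟨z, hz⟩ v, 0, ?_⟩
        rw [tmul_zero, add_zero, ← mul_single_tmul, one_mul]
      · have hwz : w * z ∈ G := (mul_mem_iff_of_notMem hw).2 hz
        -- `c z = w⁻¹ · c̄ (w z)`: the scalar is conjugated on passing `w⁻¹`.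
        refine ⟨0, conj c • ρ ⟨w * z, hwz⟩ v, ?_⟩
        rw [tmul_zero, zero_add, ← mul_single_tmul, SkewGroupAlgebra.single_mul_single,
          twist_of_notMem G (inv_notMem hw)]
        simp

/-- The map `s ⊗ v ↦ s (f v)` before passing to the quotient. -/
def preLift (τ : ARep G X) (f : V →ₗ[ℂ] X) : SkewGroupAlgebra G ⊗[ℤ] V →+ X :=
  TensorProduct.liftAddHom
    { toFun := fun s => (skewAction τ s).toAddMonoidHom.comp f.toAddMonoidHom
      map_zero' := by ext; simp
      map_add' := fun s t => by ext; simp }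
    (fun n s v => by simp)

theorem preLift_tmul (τ : ARep G X) (f : V →ₗ[ℂ] X) (s : SkewGroupAlgebra G) (v : V) :
    preLift τ f (s ⊗ₜ v) = skewAction τ s (f v) := rfl

theorem preLift_smul (τ : ARep G X) (f : V →ₗ[ℂ] X) (s : SkewGroupAlgebra G)
    (x : SkewGroupAlgebra G ⊗[ℤ] V) : preLift τ f (s • x) = skewAction τ s (preLift τ f x) := by
  induction x using TensorProduct.induction_on with
  | zero => simp
  | tmul t v =>
    rw [TensorProduct.smul_tmul', preLift_tmul, preLift_tmul, smul_eq_mul, map_mul,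
      Module.End.mul_apply]
  | add x y hx hy => rw [smul_add, map_add, map_add, map_add, hx, hy]

/-- The map `V↑ → X` attached to an equivariant map `V → X↓`. -/
def lift (τ : ARep G X) (f : V →ₗ[ℂ] X) (hf : ∀ g v, f (ρ g v) = τ.res g (f v)) :
    Induced ρ →+ X :=
  letI : Module (SkewGroupAlgebra G) X := Module.compHom X (skewAction τ)
  let L : SkewGroupAlgebra G ⊗[ℤ] V →ₗ[SkewGroupAlgebra G] X :=
    { toFun := preLift τ f
      map_add' := map_add _
      map_smul' := preLift_smul τ f }
  ((balancedRelations ρ).liftQ L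
    (by
      rw [balancedRelations, Submodule.span_le]
      rintro _ ⟨s, c, g, v, rfl⟩
      have h : ∀ x, L x = preLift τ f x := fun x => rfl
      refine LinearMap.mem_ker.2 ((h _).trans ?_)
      rw [map_sub, preLift_tmul, preLift_tmul, sub_eq_zero, map_mul, Module.End.mul_apply,
        skewAction_single, LinearMap.map_smul, hf]
      rfl)).toAddMonoidHom

theorem lift_tmul (τ : ARep G X) (f : V →ₗ[ℂ] X) (hf : ∀ g v, f (ρ g v) = τ.res g (f v))
    (s : SkewGroupAlgebra G) (v : V) : lift τ f hf (tmul ρ s v) = skewAction τ s (f v) := rfl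

theorem lift_smul (τ : ARep G X) (f : V →ₗ[ℂ] X) (hf : ∀ g v, f (ρ g v) = τ.res g (f v))
    (s : SkewGroupAlgebra G) (x : Induced ρ) :
    lift τ f hf (s • x) = skewAction τ s (lift τ f hf x) := by
  induction x using induction with
  | add x y hx hy => rw [smul_add, map_add, map_add, map_add, hx, hy]
  | tmul t v =>
    change lift τ f hf (tmul ρ (s * t) v) = _
    rw [lift_tmul, lift_tmul, map_mul, Module.End.mul_apply]

end Induced

/-- If `X` is the direct sum of the images of `V` under `f` and `w⁻¹ f`, then `X ≅ V↑`. -/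
theorem ind_isIso (hw : w ∉ G) (τ : ARep G X) (f : V →ₗ[ℂ] X)
    (hf : ∀ g v, f (ρ g v) = τ.res g (f v))
    (hinj : ∀ u v, f u + τ.ρ w⁻¹ (f v) = 0 → u = 0 ∧ v = 0)
    (hsurj : ∀ x, ∃ u v, f u + τ.ρ w⁻¹ (f v) = x) : (ind ρ).IsIso τ := by
  have hlift (u v : V) : Induced.lift τ f hf
      (Induced.tmul ρ 1 u + Induced.tmul ρ (.single w⁻¹ 1) v) = f u + τ.ρ w⁻¹ (f v) := by
    rw [map_add, Induced.lift_tmul, Induced.lift_tmul, skewAction_single, map_one, one_smul]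
    rfl
  let F : Induced ρ →ₗ[ℂ] X :=
    { toFun := Induced.lift τ f hf
      map_add' := map_add _
      map_smul' := fun c x => by
        rw [Induced.smul_def, Induced.lift_smul, skewAction_single, map_one]
        rfl }
  refine ⟨LinearEquiv.ofBijective F ⟨(injective_iff_map_eq_zero F).2 fun x hx => ?_, fun x => ?_⟩,
    fun z x => ?_⟩
  · obtain ⟨u, v, rfl⟩ := Induced.exists_eq hw x
    obtain ⟨rfl, rfl⟩ := hinj u v ((hlift u v).symm.trans hx)
    rw [Induced.tmul_zero, Induced.tmul_zero, add_zero]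
  · obtain ⟨u, v, rfl⟩ := hsurj x
    exact ⟨Induced.tmul ρ 1 u + Induced.tmul ρ (.single w⁻¹ 1) v, hlift u v⟩
  · change Induced.lift τ f hf ((SkewGroupAlgebra.single z 1 : SkewGroupAlgebra G) • x) = _
    rw [Induced.lift_smul, skewAction_single, one_smul]
    rfl

end GradedGroup

/-! ### Restriction, induction, dimension and indicator in the two cases -/

section GradedGroup

variable {Γ : Type*} [Group Γ] {G : Subgroup Γ} {w : Γ}
  {W : Type*} [AddCommGroup W] [Module ℂ W] {σ : ARep G W} {V : Subrepresentation σ.res}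

theorem subtype_comm (V : Subrepresentation σ.res) (g : G) (v : V.toSubmodule) :
    V.toSubmodule.subtype (V.toRepresentation g v) = σ.res g (V.toSubmodule.subtype v) := rfl

theorem finrank_of_bijective [FiniteDimensional ℂ W] {hw : w ∉ G}
    (h : Function.Bijective (oddSum hw V)) :
    Module.finrank ℂ W = 2 * Module.finrank ℂ V.toSubmodule := by
  rw [← (LinearEquiv.ofBijective _ h).finrank_eq, Module.finrank_prod, finrank_conj, two_mul]

variable [Fact (G.index = 2)]

/-- The restriction of an A-representation is isomorphic to any subrepresentation filling it. -/
def equivOfEqTop (h : V.toSubmodule = ⊤) : σ.res.Equiv V.toRepresentation :=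
  (Representation.Equiv.mk (LinearEquiv.ofTop V.toSubmodule h) fun g =>
    LinearMap.ext fun v => subtype_comm V g v).symm

theorem exists_isTwisted_of_eq_top (hw : w ∉ G) (h : V.toSubmodule = ⊤) :
    ∃ J, IsTwisted w V.toRepresentation J ∧ ∀ v, J (J v) = V.toRepresentation (sq w) v := by
  have hmem (x : W) : x ∈ V.toSubmodule := h ▸ Submodule.mem_top
  refine ⟨{ toFun := fun v => ⟨σ.ρ w v, hmem _⟩
            map_add' := fun u v => Subtype.ext (map_add (σ.ρ w) _ _)
            map_smul' := fun c v => Subtype.ext (σ.smul_of_notMem hw c v) },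
    fun g v => Subtype.ext (σ.isTwisted_odd hw g v), fun v => Subtype.ext (σ.odd_odd hw v)⟩

/-- Embed `V` by `v ↦ (v, i v)`. Its translate by the antilinear `w⁻¹` is the graph of `-i`, and the
graphs of `i` and `-i` are complementary in `W ⊕ W`. -/
theorem ind_isIso_prod (hw : w ∉ G) (h : V.toSubmodule = ⊤) :
    (ind V.toRepresentation).IsIso (σ.prod σ) := by
  have hmem (x : W) : x ∈ V.toSubmodule := h ▸ Submodule.mem_top
  let f : V.toSubmodule →ₗ[ℂ] W × W :=
    V.toSubmodule.subtype.prod (Complex.I • V.toSubmodule.subtype)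
  have hodd (u v : V.toSubmodule) : f u + (σ.prod σ).ρ w⁻¹ (f v) =
      ((u : W) + σ.ρ w⁻¹ v, Complex.I • ((u : W) - σ.ρ w⁻¹ v)) := by
    change ((u : W) + σ.ρ w⁻¹ v, Complex.I • (u : W) + σ.ρ w⁻¹ (Complex.I • (v : W))) = _
    rw [σ.smul_of_notMem (inv_notMem hw), Complex.conj_I, neg_smul, smul_sub, sub_eq_add_neg]
  refine ind_isIso hw (σ.prod σ) f (fun g v => ?_) (fun u v huv => ?_) fun x => ?_
  · exact Prod.ext rfl (map_smul (σ.res g) Complex.I (v : W)).symm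
  · rw [hodd, Prod.mk_eq_zero, smul_eq_zero_iff_right Complex.I_ne_zero, sub_eq_zero] at huv
    obtain ⟨h1, h2⟩ := huv
    have hu : (u : W) = 0 := by
      rw [← h2, ← two_smul ℂ, smul_eq_zero_iff_right two_ne_zero] at h1
      exact h1
    refine ⟨Subtype.ext hu, Subtype.ext ?_⟩
    rw [← σ.self_apply_inv w (v : W), ← h2, hu, map_zero]
    rfl
  · have hI (y : W) : Complex.I • (-Complex.I) • y = y := by rw [smul_smul]; simp
    -- The solution of `u + w⁻¹ v = x.1` and `i (u - w⁻¹ v) = x.2`.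
    refine ⟨⟨(2 : ℂ)⁻¹ • (x.1 + (-Complex.I) • x.2), hmem _⟩,
      ⟨σ.ρ w ((2 : ℂ)⁻¹ • (x.1 - (-Complex.I) • x.2)), hmem _⟩, ?_⟩
    rw [hodd]
    have h2 (y : W) : (2 : ℂ)⁻¹ • y + (2 : ℂ)⁻¹ • y = y := by
      rw [← add_smul]; norm_num
    refine Prod.ext ?_ ?_
    · simp only [σ.inv_apply_self]
      rw [← smul_add, add_add_sub_cancel, smul_add, h2]
    · simp only [σ.inv_apply_self]
      rw [← smul_sub, add_sub_sub_cancel, smul_add, h2, hI]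

theorem ind_isIso_of_bijective {hw : w ∉ G} (h : Function.Bijective (oddSum hw V)) :
    (ind V.toRepresentation).IsIso σ := by
  refine ind_isIso hw σ V.toSubmodule.subtype (subtype_comm V) (fun u v huv => ?_) fun x => ?_
  · have h1 : oddSum hw V (u, v) = 0 := huv
    have h2 := h.1 (h1.trans (map_zero _).symm)
    exact ⟨congrArg Prod.fst h2, congrArg Prod.snd h2⟩
  · obtain ⟨⟨u, v⟩, rfl⟩ := h.2 x
    exact ⟨u, v, rfl⟩

/-- `W↓ ≅ V ⊕ w·V̄`. -/
def oddSumEquiv {hw : w ∉ G} (h : Function.Bijective (oddSum hw V)) :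
    (V.toRepresentation.prod (twistRep w (conjRep V.toRepresentation))).Equiv σ.res :=
  .mk (LinearEquiv.ofBijective _ h) fun g => LinearMap.ext fun x => oddSum_comm hw V g x

theorem indicator_of_isTwisted [Fintype Γ] [FiniteDimensional ℂ W]
    (hw : w ∉ G) (hV : V.toRepresentation.IsIrreducible)
    {J : V.toSubmodule →ₛₗ[starRingEnd ℂ] V.toSubmodule}
    (hJ : IsTwisted w V.toRepresentation J) {δ : ℝ} (hδ : δ = 1 ∨ δ = -1)
    (hJJ : ∀ v, J (J v) = (δ : ℂ) • V.toRepresentation (sq w) v) :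
    indicator V.toRepresentation = δ := by
  have := nontrivial_of_isIrreducible hV
  obtain ⟨v, hv⟩ := exists_ne (0 : V.toSubmodule)
  obtain ⟨⟨B, hB, hnd⟩, hall⟩ := hJ.forms hV hδ hJJ
  rw [indicator_eq_mul_finrank hw hall, finrank_intertwining_eq_one hV hB, Nat.cast_one, mul_one]
  rintro rfl
  exact hv (hnd.1 v fun _ => rfl)

end GradedGroup

end RealRep

end

/-! ### The trichotomy -/

theorem mainTheorem6 {Γ : Type*} [Group Γ] [Fintype Γ] (G : Subgroup Γ) [Fact (G.index = 2)]
    (w : Γ) (hw : w ∉ G)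
    {W : Type*} [AddCommGroup W] [Module ℂ W] (σ : RealRep.ARep G W) (hσ : σ.IsIrreducible)
    (V : Subrepresentation σ.res) (hV : V.toRepresentation.IsIrreducible) :
    -- type ℝ
    (Nonempty (σ.endA ≃ₐ[ℝ] ℝ) ∧
      Nonempty (σ.res.IntertwiningMap σ.res ≃ₐ[ℂ] ℂ) ∧
      Nonempty (σ.res.Equiv V.toRepresentation) ∧
      (RealRep.ind V.toRepresentation).IsIso (σ.prod σ) ∧
      (∃ n : ℕ, 0 < n ∧ Module.finrank ℂ W = n ∧ Module.finrank ℂ V.toSubmodule = n) ∧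
      Nonempty (V.toRepresentation.Equiv (RealRep.twistRep w (RealRep.conjRep V.toRepresentation))) ∧
      RealRep.IsRealisable V.toRepresentation ∧
      ((∃ B, RealRep.IsInvariantForm w V.toRepresentation B ∧ B.Nondegenerate) ∧
        ∀ B, RealRep.IsInvariantForm w V.toRepresentation B → RealRep.IsSymmetricForm w V.toRepresentation B) ∧
      RealRep.indicator V.toRepresentation = 1) ∨
    -- type ℂ
    (Nonempty (σ.endA ≃ₐ[ℝ] ℂ) ∧
      Nonempty (σ.res.IntertwiningMap σ.res ≃ₐ[ℂ] ℂ × ℂ) ∧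
      Nonempty (σ.res.Equiv (V.toRepresentation.prod (RealRep.twistRep w (RealRep.conjRep V.toRepresentation)))) ∧
      (RealRep.ind V.toRepresentation).IsIso σ ∧
      (∃ n : ℕ, 0 < n ∧ Module.finrank ℂ W = 2 * n ∧ Module.finrank ℂ V.toSubmodule = n) ∧
      ¬ Nonempty (V.toRepresentation.Equiv (RealRep.twistRep w (RealRep.conjRep V.toRepresentation))) ∧
      ¬ RealRep.IsRealisable V.toRepresentation ∧
      (∀ B, RealRep.IsInvariantForm w V.toRepresentation B → B = 0) ∧
      RealRep.indicator V.toRepresentation = 0) ∨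
    -- type ℍ
    (Nonempty (σ.endA ≃ₐ[ℝ] ℍ[ℝ]) ∧
      Nonempty (σ.res.IntertwiningMap σ.res ≃ₐ[ℂ] Matrix (Fin 2) (Fin 2) ℂ) ∧
      Nonempty (σ.res.Equiv (V.toRepresentation.prod V.toRepresentation)) ∧
      (RealRep.ind V.toRepresentation).IsIso σ ∧
      (∃ n : ℕ, 0 < n ∧ Module.finrank ℂ W = 2 * n ∧ Module.finrank ℂ V.toSubmodule = n) ∧
      Nonempty (V.toRepresentation.Equiv (RealRep.twistRep w (RealRep.conjRep V.toRepresentation))) ∧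
      ¬ RealRep.IsRealisable V.toRepresentation ∧
      ((∃ B, RealRep.IsInvariantForm w V.toRepresentation B ∧ B.Nondegenerate) ∧
        ∀ B, RealRep.IsInvariantForm w V.toRepresentation B → RealRep.IsAlternatingForm w V.toRepresentation B) ∧
      RealRep.indicator V.toRepresentation = -1) := by
  have hfd : FiniteDimensional ℂ W := hσ.finiteDimensional
  have := RealRep.nontrivial_of_isIrreducible hV
  have hpos : 0 < Module.finrank ℂ V.toSubmodule := Module.finrank_pos
  have hV' := RealRep.isIrreducible_twistRep_conjRep hV w
  rcases RealRep.eq_top_or_bijective_oddSum hw hσ hV with htop | hbij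
  · left
    have e := RealRep.equivOfEqTop htop
    have hirr := RealRep.isIrreducible_of_equiv e hV
    obtain ⟨J, hJ, hJJ⟩ := RealRep.exists_isTwisted_of_eq_top (V := V) hw htop
    have hJJ' : ∀ v, J (J v) = ((1 : ℝ) : ℂ) • V.toRepresentation (RealRep.sq w) v := fun v => by
      rw [hJJ, Complex.ofReal_one, one_smul]
    have hJ0 : J ≠ 0 := by
      rintro rfl
      obtain ⟨v, hv⟩ := exists_ne (0 : V.toSubmodule)
      have h := hJJ v
      rw [LinearMap.zero_apply] at h
      exact hv (by rw [← RealRep.rep_inv_apply_self V.toRepresentation (RealRep.sq w) v, ← h,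
        map_zero])
    obtain ⟨hex, hall⟩ := hJ.forms hV (.inl rfl) hJJ'
    refine ⟨RealRep.endA_real hw hirr, RealRep.exists_algEquiv_complex hirr, ⟨e⟩,
      RealRep.ind_isIso_prod hw htop, ⟨_, hpos, e.toLinearEquiv.finrank_eq, rfl⟩,
      hJ.nonempty_equiv hV hJ0, hJ.isRealisable hw hJJ, ⟨hex, fun B hB u v => ?_⟩, ?_⟩
    · rw [hall B hB, Complex.ofReal_one, one_mul]
    · rw [RealRep.indicator_of_isTwisted hw hV hJ (.inl rfl) hJJ', Complex.ofReal_one]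
  · right
    have hnr := RealRep.not_isRealisable_of_injective hσ hV hbij.1
    have hind := RealRep.ind_isIso_of_bijective hbij
    have hdim := RealRep.finrank_of_bijective hbij
    have e := (RealRep.oddSumEquiv hbij).symm
    by_cases hiso : Nonempty
        (V.toRepresentation.Equiv (RealRep.twistRep w (RealRep.conjRep V.toRepresentation)))
    · right
      obtain ⟨e'⟩ := hiso
      obtain ⟨J₀, hJ₀, h0⟩ := RealRep.exists_isTwisted_of_equiv e'
      obtain ⟨δ, J, hδ, hJ, hJJ⟩ := hJ₀.exists_normalised hV h0
      -- With `δ = 1` the map `J` would make `V` Realisable, which the decomposition of `W`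
      -- excludes.
      obtain rfl : δ = -1 := hδ.resolve_left fun h => hnr (hJ.isRealisable hw fun v => by
        rw [hJJ, h, Complex.ofReal_one, one_smul])
      have hJJ' : ∀ v, J (J v) = -V.toRepresentation (RealRep.sq w) v := fun v => by
        rw [hJJ, Complex.ofReal_neg, Complex.ofReal_one, neg_one_smul]
      have hJ0 : J ≠ 0 := by
        rintro rfl
        obtain ⟨v, hv⟩ := exists_ne (0 : V.toSubmodule)
        have h := hJJ' v
        rw [LinearMap.zero_apply, eq_comm, neg_eq_zero] at h
        exact hv (by rw [← RealRep.rep_inv_apply_self V.toRepresentation (RealRep.sq w) v, h,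
          map_zero])
      have hJb : Function.Bijective J := ⟨hJ.injective hV hJ0, hJ.surjective hV hJ0⟩
      let e₂ : (V.toRepresentation.prod V.toRepresentation).Equiv σ.res :=
        .mk (RealRep.quaternionicEquiv hbij hJb) fun g =>
          LinearMap.ext fun x => RealRep.quaternionicEquiv_comm hbij hJb hJ g x
      obtain ⟨hex, hall⟩ := hJ.forms hV (.inr rfl) hJJ
      obtain ⟨φ⟩ := RealRep.exists_algEquiv_matrix hV
      refine ⟨RealRep.endA_quaternion hV hbij hJb hJ hJJ',
        ⟨(RealRep.intertwiningConj e₂.symm).trans φ⟩, ⟨e₂.symm⟩, hind, ⟨_, hpos, hdim, rfl⟩, ⟨e'⟩,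
        hnr, ⟨hex, fun B hB u v => ?_⟩, ?_⟩
      · rw [hall B hB, Complex.ofReal_neg, Complex.ofReal_one, neg_one_mul]
      · rw [RealRep.indicator_of_isTwisted hw hV hJ (.inr rfl) hJJ, Complex.ofReal_neg,
          Complex.ofReal_one]
    · left
      obtain ⟨φ⟩ := RealRep.exists_algEquiv_prod hV hV' hiso
      have hJ : ∀ J, RealRep.IsTwisted w V.toRepresentation J → J = 0 := fun J hJ => by
        by_contra h0
        exact hiso (hJ.nonempty_equiv hV h0)
      have hforms : ∀ B, RealRep.IsInvariantForm w V.toRepresentation B → B = 0 :=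
        fun B hB => RealRep.form_eq_zero hJ hB
      refine ⟨RealRep.endA_complex hV hbij hiso, ⟨(RealRep.intertwiningConj e).trans φ⟩, ⟨e⟩, hind,
        ⟨_, hpos, hdim, rfl⟩, hiso, hnr, hforms, ?_⟩
      -- The zero form has every symmetry type, so `δ = 0` may be chosen.
      rw [RealRep.indicator_eq_mul_finrank hw (δ := 0) fun B hB u v => by simp [hforms B hB],
        zero_mul]
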